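/- Let $A\in\mathbb R^{m\times d}$ be a nonzero matrix, $b\in\mathbb R^m$, and let $\delta>0$ be the smallest nonzero eigenvalue of $A^\top A$; $\|A\|$ is the spectral norm and $\|\cdot\|$ the Euclidean norm on vectors. Consider the problem $\min_{x\in\mathbb R^d} f(x)$ subject to $Ax=b$, where $f:\mathbb R^d\to\mathbb R$ is differentiable and is accessed through a stochastic gradient $\tilde\nabla f(x,\xi)$ (jointly measurable), $\xi\sim P$, with $\mathbb E_\xi[\tilde\nabla f(x,\xi)]=\nabla f(x)$. Assume that for some $L_f>0$ and $V\in\mathbb R$ and all $x,u,v\in\mathbb R^d$, $$\mathbb E_\xi\|\tilde\nabla f(u,\xi)-\tilde\nabla f(v,\xi)\|^2\le L_f^2\|u-v\|^2,\qquad \mathbb E_\xi\|\tilde\nabla f(x,\xi)-\nabla f(x)\|^2\le V^2,\qquad f(x)\ge 0 .$$ Let $c_1,c_2,c_3,c_4>0$ be arbitrary and put $$c=121L_f^2,\qquad m_0=\min\Big(\tfrac{1}{448L_f},\tfrac{1}{32(1+c_2+c_3)L_f},\tfrac{1}{8(1+2c_3)L_f}\Big),$$ $$\rho=\max\Big(\tfrac{7(1+c_1)}{m_0\delta},\tfrac{4(6+c_4)(1+c_1)L_f}{\delta},\tfrac{168(1+c_1)L_f}{\delta}\Big),\qquad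 \eta=\tfrac{1}{11(L_f+\rho\|A\|^2)},$$ $$k_0=\max\Big(\big(\tfrac{10m_0}{3c_1\eta}\big)^2,\big(\tfrac{20}{3\eta c_2L_f}\big)^2,\big(\tfrac{10}{3c_3L_f}\big)^2,\tfrac{400}{3\eta^2c_4L_f^2},\big(\tfrac{20}{c\eta^2}\big)^4,\big(\tfrac{50}{3c\eta^2}\big)^6,2\Big),$$ $$\eta_k=\frac{\eta}{(k+k_0)^{1/3}\log(k+k_0)},\qquad \alpha_k=c\,\eta_k^2 .$$ From arbitrary deterministic $x_0,g_0\in\mathbb R^d$, $\lambda_0\in\mathbb R^m$ and i.i.d. samples $\xi_1,\xi_2,\dots\sim P$, define for $k\ge 0$ $$x_{k+1}=x_k-\eta_{k+1}\big(g_k+A^\top\lambda_k+\rho A^\top(Ax_k-b)\big),\qquad \lambda_{k+1}=\lambda_k+\rho(Ax_{k+1}-b),$$ $$g_{k+1}=\tilde\nabla f(x_{k+1},\xi_{k+1})+(1-\alpha_{k+1})\big(g_k-\tilde\nabla f(x_k,\xi_{k+1})\big).$$ Then all the expectations below are finite, and for every $K\ge 1$ $$\frac1K\sum_{k=1}^{K+1}\mathbb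 E\Big[\|\eta_k^{-1}(x_k-x_{k-1})\|^2+\|g_{k-1}-\nabla f(x_{k-1})\|^2\Big]\le \frac{C}{\eta_{K+1}K}\le C'\,K^{-2/3}\log(K+1),$$ that is, the average is $O\big(1/(\eta_{K+1}K)\big)=\widetilde O(K^{-2/3})$. The constants $C,C'$ do not depend on $K$; they depend only on $A,b,L_f,V,c_1,\dots,c_4,x_0,\lambda_0,g_0$ and an upper bound $F_0$ on $f(x_0)$. -/

import Mathlib

open MeasureTheory ProbabilityTheory

noncomputable section

namespace StochLALM

/-- The real numbers from which all the parameters of the method are computed: the smoothness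
constant `Lf`, the smallest nonzero eigenvalue `δ` of `Aᵀ A`, the spectral norm `normA` of `A`, and
four free constants. -/
structure ParamData where
  Lf : ℝ
  δ : ℝ
  normA : ℝ
  c₁ : ℝ
  c₂ : ℝ
  c₃ : ℝ
  c₄ : ℝ

namespace ParamData

variable (p : ParamData)

def c : ℝ := 121 * p.Lf ^ 2

def m : ℝ :=
  min (1 / (448 * p.Lf))
    (min (1 / (32 * (1 + p.c₂ + p.c₃) * p.Lf)) (1 / (8 * (1 + 2 * p.c₃) * p.Lf)))

/-- The penalty parameter, which is also the dual step size; it does not change along the run. -/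
def ρ : ℝ :=
  max (7 * (1 + p.c₁) / (p.m * p.δ))
    (max (4 * (6 + p.c₄) * (1 + p.c₁) * p.Lf / p.δ) (168 * (1 + p.c₁) * p.Lf / p.δ))

def η : ℝ := 1 / (11 * (p.Lf + p.ρ * p.normA ^ 2))

def k₀ : ℝ :=
  max ((10 * p.m / (3 * p.c₁ * p.η)) ^ 2)
    (max ((20 / (3 * p.η * p.c₂ * p.Lf)) ^ 2)
      (max ((10 / (3 * p.c₃ * p.Lf)) ^ 2)
        (max (400 / (3 * p.η ^ 2 * p.c₄ * p.Lf ^ 2))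
          (max ((20 / (p.c * p.η ^ 2)) ^ 4)
            (max ((50 / (3 * p.c * p.η ^ 2)) ^ 6) 2)))))

/-- The primal step size `η_k = η / ((k + k₀)^{1/3} log (k + k₀))`. -/
def ηₖ (k : ℕ) : ℝ :=
  p.η / (((k : ℝ) + p.k₀) ^ (1 / 3 : ℝ) * Real.log ((k : ℝ) + p.k₀))

/-- The momentum parameter `α_k = c η_k²`. -/
def αₖ (k : ℕ) : ℝ := p.c * p.ηₖ k ^ 2

end ParamData

/-- `δ` is the smallest nonzero eigenvalue of `Aᵀ A`. -/
def IsSmallestNonzeroEigenvalue {d m : ℕ}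
    (A : EuclideanSpace ℝ (Fin d) →L[ℝ] EuclideanSpace ℝ (Fin m)) (δ : ℝ) : Prop :=
  IsLeast {μ : ℝ | μ ≠ 0 ∧ Module.End.HasEigenvalue
    ((ContinuousLinearMap.adjoint A ∘L A : EuclideanSpace ℝ (Fin d) →L[ℝ]
      EuclideanSpace ℝ (Fin d)) : Module.End ℝ (EuclideanSpace ℝ (Fin d))) μ} δ

/-- The assumptions on the objective `f` and on its stochastic gradient oracle `G x ξ`, where `ξ`
has law `P`: the oracle is unbiased, Lipschitz in mean square with constant `Lf`, and of variance
at most `V ^ 2`; `f` is nonnegative. Each expectation comes with the integrability that gives it a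
meaning. -/
structure OracleAssumptions {d : ℕ} {Ξ : Type*} [MeasurableSpace Ξ] (P : Measure Ξ)
    (f : EuclideanSpace ℝ (Fin d) → ℝ)
    (G : EuclideanSpace ℝ (Fin d) → Ξ → EuclideanSpace ℝ (Fin d)) (Lf V : ℝ) : Prop where
  differentiable : Differentiable ℝ f
  measurable : Measurable (Function.uncurry G)
  integrable : ∀ x, Integrable (G x) P
  unbiased : ∀ x, ∫ ξ, G x ξ ∂P = gradient f x
  integrable_sq_sub : ∀ u v, Integrable (fun ξ => ‖G u ξ - G v ξ‖ ^ 2) P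
  mean_square_smooth : ∀ u v, ∫ ξ, ‖G u ξ - G v ξ‖ ^ 2 ∂P ≤ Lf ^ 2 * ‖u - v‖ ^ 2
  integrable_sq_error : ∀ x, Integrable (fun ξ => ‖G x ξ - gradient f x‖ ^ 2) P
  variance_le : ∀ x, ∫ ξ, ‖G x ξ - gradient f x‖ ^ 2 ∂P ≤ V ^ 2
  nonneg : ∀ x, 0 ≤ f x

/-- The state of the method: primal point, dual point, gradient estimate. -/
structure State (d m : ℕ) where
  x : EuclideanSpace ℝ (Fin d)
  lam : EuclideanSpace ℝ (Fin m)
  g : EuclideanSpace ℝ (Fin d)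

/-- The primal update, with step size `η`. -/
def primalStep {d m : ℕ} (A : EuclideanSpace ℝ (Fin d) →L[ℝ] EuclideanSpace ℝ (Fin m))
    (b : EuclideanSpace ℝ (Fin m)) (ρ η : ℝ) (s : State d m) : EuclideanSpace ℝ (Fin d) :=
  s.x - η • (s.g + ContinuousLinearMap.adjoint A s.lam
    + ρ • ContinuousLinearMap.adjoint A (A s.x - b))

/-- One iteration of the stochastic linearized augmented Lagrangian method with variance reduction,
with step sizes `η`, `α`, penalty `ρ` and sample `ξ`. -/
def step {d m : ℕ} {Ξ : Type*} (A : EuclideanSpace ℝ (Fin d) →L[ℝ] EuclideanSpace ℝ (Fin m))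
    (b : EuclideanSpace ℝ (Fin m))
    (G : EuclideanSpace ℝ (Fin d) → Ξ → EuclideanSpace ℝ (Fin d))
    (ρ η α : ℝ) (ξ : Ξ) (s : State d m) : State d m where
  x := primalStep A b ρ η s
  lam := s.lam + ρ • (A (primalStep A b ρ η s) - b)
  g := G (primalStep A b ρ η s) ξ + (1 - α) • (s.g - G s.x ξ)

/-- The iterates for a sequence of samples `ξ`, started at `s₀`. Iteration `k` goes from index `k`
to index `k + 1` and uses `η_{k+1}`, `α_{k+1}` and `ξ_{k+1}`; the entry `ξ 0` is never used. -/
def iterate {d m : ℕ} {Ξ : Type*} (p : ParamData)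
    (A : EuclideanSpace ℝ (Fin d) →L[ℝ] EuclideanSpace ℝ (Fin m))
    (b : EuclideanSpace ℝ (Fin m))
    (G : EuclideanSpace ℝ (Fin d) → Ξ → EuclideanSpace ℝ (Fin d))
    (s₀ : State d m) (ξ : ℕ → Ξ) : ℕ → State d m
  | 0 => s₀
  | k + 1 => step A b G p.ρ (p.ηₖ (k + 1)) (p.αₖ (k + 1)) (ξ (k + 1)) (iterate p A b G s₀ ξ k)

/-- `‖η_k⁻¹ (x_k - x_{k-1})‖² + ‖g_{k-1} - ∇f(x_{k-1})‖²` along the iterates; used for `k ≥ 1`. -/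
def residual {d m : ℕ} {Ξ : Type*} (p : ParamData)
    (A : EuclideanSpace ℝ (Fin d) →L[ℝ] EuclideanSpace ℝ (Fin m))
    (b : EuclideanSpace ℝ (Fin m)) (f : EuclideanSpace ℝ (Fin d) → ℝ)
    (G : EuclideanSpace ℝ (Fin d) → Ξ → EuclideanSpace ℝ (Fin d))
    (s₀ : State d m) (ξ : ℕ → Ξ) (k : ℕ) : ℝ :=
  ‖(p.ηₖ k)⁻¹ • ((iterate p A b G s₀ ξ k).x - (iterate p A b G s₀ ξ (k - 1)).x)‖ ^ 2
    + ‖(iterate p A b G s₀ ξ (k - 1)).g - gradient f (iterate p A b G s₀ ξ (k - 1)).x‖ ^ 2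

end StochLALM

end

/-! The proof is a Lyapunov argument. Let v_k be the primal direction, so x_{k+1} = x_k + η_{k+1}
v_k, and the quantity to be summed is E‖v_k‖² + E‖g_k - ∇f(x_k)‖². A primal step lowers the
augmented Lagrangian by about η‖v‖², up to η times the squared gradient error, but the multiplier
step raises it by ρ‖Ax - b‖². Subtracting two consecutive primal relations expresses ρAᵀ(Ax - b)
through the changes of v and g and the second difference of x. The spectral gap δ then bounds the
rise by ‖v_k - v_{k-1}‖² and small terms. Testing the same relation against the step yields a
negative multiple of ‖v_k - v_{k-1}‖², at the price of adding multiples of ‖Ax - b‖² and ‖v‖² to the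
potential; this pays for the dual step (`potential_step_le`).

The gradient error obeys E e_{k+1} ≤ (1 - α) E e_k + small terms, because each sample is independent
of the current state (`estimator_error`). With weight 1/(8 L² η_k) in the potential, the contraction
α/η = cη beats the growth of 1/η_k, which `inv_ηₖ_sub_le` keeps below (9/10)cη. The noise left over
is of order η_k³, and the logarithm in the step size makes this summable (`total_potential_step_le`,
`sum_ηₖ_cube_le`).

The multipliers need not be bounded, so the potential has no evident lower bound. However, ⟨λ_{k+1},
Ax_{k+1} - b⟩ is at least a telescoping difference of ‖λ‖²/(2ρ), so the partial sums of the
potential are bounded below. A potential that is decreasing up to summable errors must then stay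
above a constant (`sum_decrement_le`).

Feasibility of Ax = b is not needed: Aᵀ annihilates the orthogonal complement of the range of A, so
b and λ can be replaced by their projections onto that range without changing x or g. Finally, η_k ≥
η_{K+1} in the weighted sum turns the uniform bound into the rate. -/

namespace StochLALM

open ContinuousLinearMap (adjoint)

/-! ### Elementary inequalities between the parameters -/

namespace ParamData

/-- The sign conditions under which the parameters of the method make sense. -/
structure Admissible (p : ParamData) : Prop where
  Lf_pos : 0 < p.Lf
  δ_pos : 0 < p.δ
  normA_nonneg : 0 ≤ p.normA
  c₁_pos : 0 < p.c₁
  c₂_pos : 0 < p.c₂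
  c₃_pos : 0 < p.c₃

variable {p : ParamData}

theorem Admissible.m_pos (h : p.Admissible) : 0 < p.m := by
  have := h.Lf_pos
  have := h.c₂_pos
  have := h.c₃_pos
  unfold m
  refine lt_min (by positivity) (lt_min (by positivity) (by positivity))

theorem Admissible.m_mul_Lf_le (h : p.Admissible) : p.m * p.Lf ≤ 1 / 448 := by
  have hL := h.Lf_pos
  have h1 : p.m ≤ 1 / (448 * p.Lf) := min_le_left _ _
  calc p.m * p.Lf ≤ 1 / (448 * p.Lf) * p.Lf := by gcongr
    _ = 1 / 448 := by field_simp

theorem Admissible.seven_le (h : p.Admissible) : 7 ≤ p.ρ * p.δ * p.m := by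
  have hm := h.m_pos
  have hδ := h.δ_pos
  have hc := h.c₁_pos
  have h1 : 7 * (1 + p.c₁) / (p.m * p.δ) ≤ p.ρ := le_max_left _ _
  rw [div_le_iff₀ (by positivity)] at h1
  nlinarith

theorem Admissible.ρ_pos (h : p.Admissible) : 0 < p.ρ := by
  have hm := h.m_pos
  have hδ := h.δ_pos
  have hc := h.c₁_pos
  have h1 : 7 * (1 + p.c₁) / (p.m * p.δ) ≤ p.ρ := le_max_left _ _
  exact lt_of_lt_of_le (by positivity) h1

theorem Admissible.η_pos (h : p.Admissible) : 0 < p.η := by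
  have := h.Lf_pos
  have := h.ρ_pos
  unfold η
  positivity

theorem Admissible.η_mul (h : p.Admissible) : p.η * (p.Lf + p.ρ * p.normA ^ 2) = 1 / 11 := by
  have := h.Lf_pos
  have := h.ρ_pos
  unfold η
  field_simp

theorem Admissible.Lf_mul_η_le (h : p.Admissible) : p.Lf * p.η ≤ 1 / 11 := by
  have := h.η_mul
  have : 0 ≤ p.η * (p.ρ * p.normA ^ 2) := by
    have := h.ρ_pos; have := h.η_pos; positivity
  nlinarith

theorem Admissible.c_pos (h : p.Admissible) : 0 < p.c := by
  have := h.Lf_pos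
  unfold c
  positivity

theorem Admissible.c_mul_sq_le (h : p.Admissible) : p.c * p.η ^ 2 ≤ 1 := by
  have h1 := h.Lf_mul_η_le
  have h2 : 0 ≤ p.Lf * p.η := by have := h.Lf_pos; have := h.η_pos; positivity
  unfold c
  nlinarith

theorem pow_six_le_k₀ (p : ParamData) : (50 / (3 * p.c * p.η ^ 2)) ^ 6 ≤ p.k₀ := by
  unfold k₀
  simp only [le_max_iff, le_refl, true_or, or_true]

/-- As cη² ≤ 1, the base 50/(3cη²) exceeds 10, and `k₀` dominates its sixth power. All numerical
smallness of the step sizes (log ≥ 1, cube root ≥ 100) comes from here. -/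
theorem Admissible.million_le (h : p.Admissible) (k : ℕ) :
    (10 : ℝ) ^ 6 ≤ (k : ℝ) + p.k₀ := by
  have h1 := p.pow_six_le_k₀
  have h2 : (10 : ℝ) ≤ 50 / (3 * p.c * p.η ^ 2) := by
    have := h.c_pos
    have := h.η_pos
    rw [le_div_iff₀ (by positivity)]
    have := h.c_mul_sq_le
    nlinarith
  have h3 := pow_le_pow_left₀ (by norm_num) h2 6
  have : (0 : ℝ) ≤ k := k.cast_nonneg
  linarith

end ParamData

/-! ### Growth of t^(1/3) log t -/

theorem log_le_five_twelfths_mul {z : ℝ} (hz : 0 < z) : Real.log z ≤ 5 / 12 * z := by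
  have h := Real.log_le_sub_one_of_pos (show 0 < z / Real.exp 1 by positivity)
  rw [Real.log_div hz.ne' (Real.exp_pos 1).ne', Real.log_exp] at h
  have h1 : z / Real.exp 1 ≤ 5 / 12 * z := by
    rw [div_le_iff₀ (Real.exp_pos 1)]
    have := Real.exp_one_gt_d9
    nlinarith
  linarith

theorem log_add_one_sub_log_le {t : ℝ} (ht : 0 < t) : Real.log (t + 1) - Real.log t ≤ 1 / t := by
  rw [← Real.log_div (by positivity) ht.ne']
  have h := Real.log_le_sub_one_of_pos (show 0 < (t + 1) / t by positivity)
  refine h.trans (le_of_eq ?_)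
  field_simp
  ring

theorem inv_add_one_le_log_add_one_sub_log {t : ℝ} (ht : 0 < t) :
    1 / (t + 1) ≤ Real.log (t + 1) - Real.log t := by
  have h := Real.log_le_sub_one_of_pos (show 0 < t / (t + 1) by positivity)
  rw [Real.log_div ht.ne' (by positivity)] at h
  have : t / (t + 1) - 1 = - (1 / (t + 1)) := by field_simp; ring
  linarith

theorem one_le_log_of_million_le {t : ℝ} (ht : (10 : ℝ) ^ 6 ≤ t) : 1 ≤ Real.log t := by
  rw [Real.le_log_iff_exp_le (by linarith [show (0 : ℝ) < 10 ^ 6 by norm_num])]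
  have := Real.exp_one_lt_d9
  norm_num at ht
  linarith

theorem hundred_le_rpow {t : ℝ} (ht : (10 : ℝ) ^ 6 ≤ t) : 100 ≤ t ^ (1 / 3 : ℝ) := by
  have h : ((10 : ℝ) ^ 6) ^ (1 / 3 : ℝ) ≤ t ^ (1 / 3 : ℝ) :=
    Real.rpow_le_rpow (by norm_num) ht (by norm_num)
  have h2 : ((10 : ℝ) ^ 6) ^ (1 / 3 : ℝ) = 100 := by
    rw [show ((10 : ℝ) ^ 6) = 100 ^ (3 : ℕ) by norm_num, one_div]
    exact Real.pow_rpow_inv_natCast (by norm_num) (by norm_num)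
  linarith

/-- The growth of `φ t = t ^ (1/3) * log t` over a unit step, against `φ`. -/
theorem rpow_mul_log_growth {t : ℝ} (ht : (10 : ℝ) ^ 6 ≤ t) :
    ((t + 1) ^ (1 / 3 : ℝ) * Real.log (t + 1) - t ^ (1 / 3 : ℝ) * Real.log t)
      * ((t + 1) ^ (1 / 3 : ℝ) * Real.log (t + 1)) ≤ 15 / (t + 1) ^ (1 / 6 : ℝ) := by
  have ht' : (0 : ℝ) < t := lt_of_lt_of_le (by norm_num) ht
  set s := t + 1 with hs
  have hs0 : 0 < s := by positivity
  have hq3 : (t ^ (1 / 3 : ℝ)) ^ 3 = t := by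
    rw [one_div]; exact Real.rpow_inv_natCast_pow ht'.le (n := 3) (by norm_num)
  have hp3 : (s ^ (1 / 3 : ℝ)) ^ 3 = s := by
    rw [one_div]; exact Real.rpow_inv_natCast_pow hs0.le (n := 3) (by norm_num)
  have hq100 := hundred_le_rpow ht
  have hqp : t ^ (1 / 3 : ℝ) ≤ s ^ (1 / 3 : ℝ) :=
    Real.rpow_le_rpow ht'.le (by linarith) (by norm_num)
  -- For φ(t) = t^(1/3) log t one has φ'φ = ((log t)²/3 + log t) t^(-1/3). Half of the decay is
  -- given up to absorb the logarithms: (log s)² ≤ 25u² and log s ≤ (5/2)u², where u² = s^(1/6).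
  set u := s ^ (1 / 12 : ℝ) with hu
  have hu0 : 0 < u := Real.rpow_pos_of_pos hs0 _
  have hpu : s ^ (1 / 3 : ℝ) = u ^ 4 := by
    rw [hu, ← Real.rpow_natCast, ← Real.rpow_mul hs0.le]; norm_num
  have hu2 : s ^ (1 / 6 : ℝ) = u ^ 2 := by
    rw [hu, ← Real.rpow_natCast, ← Real.rpow_mul hs0.le]; norm_num
  have hl1 : Real.log s = 12 * Real.log u := by
    rw [hu, Real.log_rpow hs0]; ring
  have hl2 : Real.log s = 6 * Real.log (u ^ 2) := by
    rw [Real.log_pow, hl1]; push_cast; ring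
  have hlog1 : Real.log s ≤ 5 * u := by
    have := log_le_five_twelfths_mul hu0; linarith
  have hlog2 : Real.log s ≤ 5 / 2 * u ^ 2 := by
    have := log_le_five_twelfths_mul (pow_pos hu0 2); linarith
  have hlog0 : 1 ≤ Real.log s := one_le_log_of_million_le (by linarith)
  have hlogd : Real.log s - Real.log t ≤ 1 / t := log_add_one_sub_log_le ht'
  rw [hu2, hpu]
  rw [hpu] at hp3 hqp
  set q := t ^ (1 / 3 : ℝ) with hq
  -- Difference of cubes: u⁴ and q are the cube roots of t + 1 and t, so their difference times at
  -- least 3q² equals at most 1.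
  have hpq : u ^ 4 - q ≤ 1 / (3 * q ^ 2) := by
    rw [le_div_iff₀ (by positivity)]
    have : (u ^ 4) ^ 3 - q ^ 3 = 1 := by rw [hp3, hq3, hs]; ring
    nlinarith [mul_nonneg (sub_nonneg.2 hqp) (sub_nonneg.2 hqp), sub_nonneg.2 hqp]
  have hdiff : u ^ 4 * Real.log s - q * Real.log t ≤ (Real.log s / 3 + 1) / q ^ 2 := by
    have e1 : u ^ 4 * Real.log s - q * Real.log t
        = (u ^ 4 - q) * Real.log s + q * (Real.log s - Real.log t) := by ring
    have e2 : (u ^ 4 - q) * Real.log s ≤ 1 / (3 * q ^ 2) * Real.log s := by gcongr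
    have e3 : q * (Real.log s - Real.log t) ≤ q * (1 / t) := by gcongr
    have e4 : q * (1 / t) = 1 / q ^ 2 := by
      rw [← hq3]; field_simp
    rw [e1]
    calc _ ≤ 1 / (3 * q ^ 2) * Real.log s + 1 / q ^ 2 := by linarith
      _ = _ := by field_simp
  have hpq2 : u ^ 4 ≤ 11 / 10 * q := by
    have : 1 / (3 * q ^ 2) ≤ 1 := by
      rw [div_le_one (by positivity)]; nlinarith
    linarith
  calc _ ≤ (Real.log s / 3 + 1) / q ^ 2 * (u ^ 4 * Real.log s) := by gcongr
    _ = (Real.log s * Real.log s / 3 + Real.log s) * (u ^ 4 / q ^ 2) := by ring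
    _ ≤ ((5 * u) * (5 * u) / 3 + 5 / 2 * u ^ 2) * (u ^ 4 / q ^ 2) := by gcongr
    _ = 65 / 6 * (u ^ 6 / q ^ 2) := by ring
    _ ≤ 65 / 6 * ((121 / 100) / u ^ 2) := by
        refine mul_le_mul_of_nonneg_left ?_ (by norm_num)
        rw [div_le_div_iff₀ (by positivity) (by positivity)]
        calc u ^ 6 * u ^ 2 = (u ^ 4) ^ 2 := by ring
          _ ≤ (11 / 10 * q) ^ 2 := by gcongr
          _ = _ := by ring
    _ ≤ 15 / u ^ 2 := by
        rw [← mul_div_assoc]; gcongr; norm_num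

/-! ### Properties of the step sizes -/

namespace ParamData

variable {p : ParamData}

theorem Admissible.denom_ge (h : p.Admissible) (k : ℕ) :
    100 ≤ ((k : ℝ) + p.k₀) ^ (1 / 3 : ℝ) * Real.log ((k : ℝ) + p.k₀) := by
  have h1 := hundred_le_rpow (h.million_le k)
  have h2 := one_le_log_of_million_le (h.million_le k)
  nlinarith

theorem Admissible.ηₖ_pos (h : p.Admissible) (k : ℕ) : 0 < p.ηₖ k := by
  have := h.denom_ge k
  exact div_pos h.η_pos (by linarith)

theorem Admissible.ηₖ_le (h : p.Admissible) (k : ℕ) : p.ηₖ k ≤ p.η / 100 := by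
  have := h.denom_ge k
  have := h.η_pos
  unfold ηₖ
  gcongr

theorem Admissible.ηₖ_antitone (h : p.Admissible) : Antitone p.ηₖ := by
  refine antitone_nat_of_succ_le fun k => ?_
  have h0 := h.million_le k
  have h1 := h.denom_ge k
  have := h.η_pos
  have h2 := one_le_log_of_million_le h0
  have h3 := hundred_le_rpow h0
  have hpos : 0 < (k : ℝ) + p.k₀ := lt_of_lt_of_le (by norm_num) h0
  have hk : (k : ℝ) + p.k₀ ≤ ((k + 1 : ℕ) : ℝ) + p.k₀ := by push_cast; linarith
  unfold ηₖ
  refine div_le_div_of_nonneg_left this.le (by linarith) ?_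
  exact mul_le_mul (Real.rpow_le_rpow hpos.le hk (by norm_num)) (Real.log_le_log hpos hk)
    (by linarith) (Real.rpow_nonneg (hpos.le.trans hk) _)

/-- The weight 1/η_k of the gradient error must grow more slowly than the momentum contracts, α/η =
cη; a tenth of the contraction is kept. After clearing denominators this is 15/(t+1)^(1/6) ≤
(9/10)cη², which is what the sixth-power entry of `k₀` provides. -/
theorem Admissible.inv_ηₖ_sub_le (h : p.Admissible) (k : ℕ) :
    1 / p.ηₖ (k + 1) - 1 / p.ηₖ k ≤ 9 / 10 * p.c * p.ηₖ (k + 1) := by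
  have h0 := h.million_le k
  have hη := h.η_pos
  have hc := h.c_pos
  have hgr := rpow_mul_log_growth h0
  have hd0 := h.denom_ge k
  have hd1 := h.denom_ge (k + 1)
  have e : ((k + 1 : ℕ) : ℝ) + p.k₀ = (k : ℝ) + p.k₀ + 1 := by push_cast; ring
  unfold ηₖ
  rw [e] at hd1 ⊢
  set t := (k : ℝ) + p.k₀
  have ht0 : 0 < t := lt_of_lt_of_le (by norm_num) h0
  have h6 : 50 / (3 * p.c * p.η ^ 2) ≤ (t + 1) ^ (1 / 6 : ℝ) := by
    have h1 := p.pow_six_le_k₀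
    have h2 : (50 / (3 * p.c * p.η ^ 2)) ^ 6 ≤ t + 1 := by
      have : (0 : ℝ) ≤ k := k.cast_nonneg
      simp only [t]; linarith
    have h3 : ((50 / (3 * p.c * p.η ^ 2)) ^ 6) ^ (1 / 6 : ℝ) ≤ (t + 1) ^ (1 / 6 : ℝ) :=
      Real.rpow_le_rpow (by positivity) h2 (by norm_num)
    rw [one_div] at h3
    rwa [← one_div, show (1 / 6 : ℝ) = ((6 : ℕ) : ℝ)⁻¹ by norm_num,
      Real.pow_rpow_inv_natCast (by positivity) (by norm_num),
      show ((6 : ℕ) : ℝ)⁻¹ = (1 / 6 : ℝ) by norm_num] at h3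
  set φ₁ := (t + 1) ^ (1 / 3 : ℝ) * Real.log (t + 1)
  set φ₀ := t ^ (1 / 3 : ℝ) * Real.log t
  have h15 : 15 / (t + 1) ^ (1 / 6 : ℝ) ≤ 9 / 10 * (p.c * p.η ^ 2) := by
    rw [div_le_iff₀ (by positivity)]
    rw [div_le_iff₀ (by positivity)] at h6
    nlinarith
  have hφ₁ : 0 < φ₁ := by linarith
  rw [one_div_div, one_div_div, ← sub_div, div_le_iff₀ hη]
  have : 9 / 10 * p.c * (p.η / φ₁) * p.η = 9 / 10 * (p.c * p.η ^ 2) / φ₁ := by ring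
  rw [this, le_div_iff₀ hφ₁]
  linarith

/-- The cube is η³/((t+1) log³(t+1)), a discrete derivative of -1/log with one logarithm to spare.
This telescoping form is the role of the logarithm in the step size. -/
theorem Admissible.ηₖ_cube_le (h : p.Admissible) (k : ℕ) :
    p.ηₖ (k + 1) ^ 3 ≤ p.η ^ 3 *
      (1 / Real.log ((k : ℝ) + p.k₀) - 1 / Real.log (((k + 1 : ℕ) : ℝ) + p.k₀)) := by
  have h0 := h.million_le k
  have hη := h.η_pos
  have e : ((k + 1 : ℕ) : ℝ) + p.k₀ = (k : ℝ) + p.k₀ + 1 := by push_cast; ring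
  unfold ηₖ
  rw [e]
  set t := (k : ℝ) + p.k₀
  have ht0 : 0 < t := lt_of_lt_of_le (by norm_num) h0
  have hl0 := one_le_log_of_million_le h0
  have hl1 := one_le_log_of_million_le (show (10 : ℝ) ^ 6 ≤ t + 1 by linarith)
  have hmono : Real.log t ≤ Real.log (t + 1) := Real.log_le_log ht0 (by linarith)
  have hp3 : ((t + 1) ^ (1 / 3 : ℝ)) ^ 3 = t + 1 := by
    rw [one_div]; exact Real.rpow_inv_natCast_pow (by positivity) (n := 3) (by norm_num)
  have hlow := inv_add_one_le_log_add_one_sub_log ht0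
  rw [div_pow, mul_pow, hp3, div_eq_mul_one_div]
  gcongr
  set a := Real.log t
  set b := Real.log (t + 1)
  have : 1 / a - 1 / b = (b - a) / (a * b) := by
    have : a ≠ 0 := by linarith
    have : b ≠ 0 := by linarith
    field_simp
  rw [this]
  calc 1 / ((t + 1) * b ^ 3) = 1 / (t + 1) / b ^ 3 := by field_simp
    _ ≤ (b - a) / b ^ 3 := by gcongr
    _ ≤ (b - a) / (a * b) := by
      refine div_le_div_of_nonneg_left (by linarith) (by positivity) ?_
      nlinarith [mul_le_mul_of_nonneg_left hmono (show 0 ≤ b by linarith),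
        mul_le_mul_of_nonneg_left hl1 (show 0 ≤ b * b by positivity)]

theorem Admissible.sum_ηₖ_cube_le (h : p.Admissible) (n : ℕ) :
    ∑ k ∈ Finset.range n, p.ηₖ (k + 1) ^ 3 ≤ p.η ^ 3 := by
  have hη := h.η_pos
  calc _ ≤ ∑ k ∈ Finset.range n, p.η ^ 3 *
      (1 / Real.log ((k : ℝ) + p.k₀) - 1 / Real.log (((k + 1 : ℕ) : ℝ) + p.k₀)) :=
        Finset.sum_le_sum fun k _ => h.ηₖ_cube_le k
    _ = p.η ^ 3 * (1 / Real.log (((0 : ℕ) : ℝ) + p.k₀) - 1 / Real.log ((n : ℝ) + p.k₀)) := by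
        rw [← Finset.mul_sum, Finset.sum_range_sub' (fun k : ℕ => 1 / Real.log ((k : ℝ) + p.k₀))]
    _ ≤ p.η ^ 3 * 1 := by
        have h0 := one_le_log_of_million_le (h.million_le 0)
        have h1 := one_le_log_of_million_le (h.million_le n)
        have h2 : 1 / Real.log (((0 : ℕ) : ℝ) + p.k₀) ≤ 1 := by
          rw [div_le_one (by linarith)]; exact h0
        have h3 : 0 ≤ 1 / Real.log ((n : ℝ) + p.k₀) := by positivity
        gcongr
        linarith
    _ = _ := mul_one _

/-- The rate in terms of `1 / η_{K+1}` is of order `K ^ (-2/3) * log (K + 1)`. -/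
theorem Admissible.one_div_ηₖ_mul_le (h : p.Admissible) {K : ℕ} (hK : 1 ≤ K) :
    1 / (p.ηₖ (K + 1) * (K : ℝ)) ≤
      (2 + p.k₀) ^ (1 / 3 : ℝ) * (1 + Real.log (1 + p.k₀) / Real.log 2) / p.η *
        ((K : ℝ) ^ (-(2 / 3) : ℝ) * Real.log ((K : ℝ) + 1)) := by
  have hη := h.η_pos
  have hk := h.million_le 0
  have hK' : (1 : ℝ) ≤ K := by exact_mod_cast hK
  have hk0 : 0 < p.k₀ := by norm_num at hk; linarith
  have hl2 : 0 < Real.log 2 := Real.log_pos (by norm_num)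
  have hlK : Real.log 2 ≤ Real.log ((K : ℝ) + 1) := Real.log_le_log (by norm_num) (by linarith)
  have hl1 : 0 ≤ Real.log (1 + p.k₀) := Real.log_nonneg (by linarith)
  have e : ((K + 1 : ℕ) : ℝ) + p.k₀ = (K : ℝ) + 1 + p.k₀ := by push_cast; ring
  have a1 : ((K : ℝ) + 1 + p.k₀) ^ (1 / 3 : ℝ) ≤ (2 + p.k₀) ^ (1 / 3 : ℝ) * (K : ℝ) ^ (1 / 3 : ℝ) := by
    rw [← Real.mul_rpow (by positivity) (by positivity)]
    exact Real.rpow_le_rpow (by positivity) (by nlinarith) (by norm_num)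
  -- The additive log(1 + k₀) becomes a factor because log(K + 1) ≥ log 2 for K ≥ 1.
  have a2 : Real.log ((K : ℝ) + 1 + p.k₀) ≤
      (1 + Real.log (1 + p.k₀) / Real.log 2) * Real.log ((K : ℝ) + 1) := by
    have : Real.log ((K : ℝ) + 1 + p.k₀) ≤ Real.log (((K : ℝ) + 1) * (1 + p.k₀)) :=
      Real.log_le_log (by positivity) (by nlinarith)
    rw [Real.log_mul (by positivity) (by positivity)] at this
    have h3 : Real.log (1 + p.k₀) ≤ Real.log (1 + p.k₀) / Real.log 2 * Real.log ((K : ℝ) + 1) := by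
      rw [div_mul_eq_mul_div, le_div_iff₀ hl2]
      gcongr
    linarith
  have hKpow : (K : ℝ) ^ (-(2 / 3) : ℝ) = (K : ℝ) ^ (1 / 3 : ℝ) / K := by
    rw [show (-(2 / 3) : ℝ) = 1 / 3 - 1 by norm_num, Real.rpow_sub_one (by positivity)]
  have hl0 : 0 ≤ Real.log ((K : ℝ) + 1 + p.k₀) := Real.log_nonneg (by linarith)
  unfold ηₖ
  rw [e, hKpow]
  calc _ = ((K : ℝ) + 1 + p.k₀) ^ (1 / 3 : ℝ) * Real.log ((K : ℝ) + 1 + p.k₀) / (p.η * K) := by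
        rw [div_mul_eq_mul_div, one_div_div]
    _ ≤ ((2 + p.k₀) ^ (1 / 3 : ℝ) * (K : ℝ) ^ (1 / 3 : ℝ)) *
          ((1 + Real.log (1 + p.k₀) / Real.log 2) * Real.log ((K : ℝ) + 1)) / (p.η * K) := by
        gcongr
    _ = _ := by field_simp

end ParamData

/-! ### Spectral gap of AᵀA -/

section SpectralGap

variable {d m : ℕ} {A : EuclideanSpace ℝ (Fin d) →L[ℝ] EuclideanSpace ℝ (Fin m)} {δ : ℝ}

theorem isSymmetric_adjoint_comp_self
    (A : EuclideanSpace ℝ (Fin d) →L[ℝ] EuclideanSpace ℝ (Fin m)) :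
    ((adjoint A ∘L A : EuclideanSpace ℝ (Fin d) →L[ℝ] EuclideanSpace ℝ (Fin d)) :
      Module.End ℝ (EuclideanSpace ℝ (Fin d))).IsSymmetric := by
  intro u v
  simp [ContinuousLinearMap.adjoint_inner_left, ContinuousLinearMap.adjoint_inner_right]

theorem eigenvalue_adjoint_comp_self_nonneg {μ : ℝ} (h : Module.End.HasEigenvalue
    ((adjoint A ∘L A : EuclideanSpace ℝ (Fin d) →L[ℝ] EuclideanSpace ℝ (Fin d)) :
      Module.End ℝ (EuclideanSpace ℝ (Fin d))) μ) : 0 ≤ μ := by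
  obtain ⟨v, hv⟩ := h.exists_hasEigenvector
  have h1 : adjoint A (A v) = μ • v := hv.apply_eq_smul
  have h2 : inner ℝ (adjoint A (A v)) v = μ * ‖v‖ ^ 2 := by
    rw [h1, real_inner_smul_left, real_inner_self_eq_norm_sq]
  rw [ContinuousLinearMap.adjoint_inner_left, real_inner_self_eq_norm_sq] at h2
  have h3 : 0 < ‖v‖ ^ 2 := by have := hv.2; positivity
  by_contra hneg
  push Not at hneg
  nlinarith [sq_nonneg ‖A v‖]

theorem IsSmallestNonzeroEigenvalue.pos (h : IsSmallestNonzeroEigenvalue A δ) : 0 < δ :=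
  lt_of_le_of_ne (eigenvalue_adjoint_comp_self_nonneg h.1.2) h.1.1.symm

/-- On the range of `A` the adjoint is bounded below by the smallest nonzero singular value. -/
theorem IsSmallestNonzeroEigenvalue.mul_norm_sq_le (h : IsSmallestNonzeroEigenvalue A δ)
    (x : EuclideanSpace ℝ (Fin d)) : δ * ‖A x‖ ^ 2 ≤ ‖adjoint A (A x)‖ ^ 2 := by
  set T : Module.End ℝ (EuclideanSpace ℝ (Fin d)) :=
    ((adjoint A ∘L A : EuclideanSpace ℝ (Fin d) →L[ℝ] EuclideanSpace ℝ (Fin d)) :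
      Module.End ℝ (EuclideanSpace ℝ (Fin d))) with hTdef
  have hT : T.IsSymmetric := isSymmetric_adjoint_comp_self A
  have hn : Module.finrank ℝ (EuclideanSpace ℝ (Fin d)) = d := by simp
  -- In an eigenbasis with eigenvalues μ_i the claim reduces to δμ_i ≤ μ_i², true because each μ_i
  -- is 0 or at least δ.
  set B := hT.eigenvectorBasis hn
  have e1 : ‖A x‖ ^ 2 = ∑ i, hT.eigenvalues hn i * (B.repr x i) ^ 2 := by
    have : ‖A x‖ ^ 2 = inner ℝ (B.repr (T x)) (B.repr x) := by
      rw [LinearIsometryEquiv.inner_map_map]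
      change _ = inner ℝ (adjoint A (A x)) x
      rw [ContinuousLinearMap.adjoint_inner_left, real_inner_self_eq_norm_sq]
    rw [this, PiLp.inner_apply]
    refine Finset.sum_congr rfl fun i _ => ?_
    rw [hT.eigenvectorBasis_apply_self_apply hn x i]
    simp [B]
    ring
  have e2 : ‖adjoint A (A x)‖ ^ 2 = ∑ i, (hT.eigenvalues hn i) ^ 2 * (B.repr x i) ^ 2 := by
    have : ‖adjoint A (A x)‖ ^ 2 = ‖B.repr (T x)‖ ^ 2 := by
      rw [LinearIsometryEquiv.norm_map]; rfl
    rw [this, EuclideanSpace.norm_sq_eq]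
    refine Finset.sum_congr rfl fun i _ => ?_
    rw [hT.eigenvectorBasis_apply_self_apply hn x i]
    simp [B, mul_pow]
  rw [e1, e2, Finset.mul_sum]
  refine Finset.sum_le_sum fun i _ => ?_
  have hev := hT.hasEigenvalue_eigenvalues hn i
  have hnn : 0 ≤ hT.eigenvalues hn i := eigenvalue_adjoint_comp_self_nonneg hev
  have hkey : δ * hT.eigenvalues hn i ≤ hT.eigenvalues hn i ^ 2 := by
    by_cases h0 : hT.eigenvalues hn i = 0
    · simp [h0]
    · have : δ ≤ hT.eigenvalues hn i := h.2 ⟨h0, hev⟩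
      nlinarith
  nlinarith [sq_nonneg (B.repr x i)]

end SpectralGap

/-! ### Functions with Lipschitz gradient -/

section Smooth

variable {E : Type*} [NormedAddCommGroup E] [InnerProductSpace ℝ E] [CompleteSpace E]
  {f : E → ℝ} {L : ℝ}

/-- The quadratic upper bound for a function with Lipschitz gradient. -/
theorem le_add_inner_gradient_add (hf : Differentiable ℝ f)
    (hL : ∀ u v, ‖gradient f u - gradient f v‖ ≤ L * ‖u - v‖) (x v : E) :
    f (x + v) ≤ f x + inner ℝ (gradient f x) v + L / 2 * ‖v‖ ^ 2 := by
  -- Up to a constant, f along the segment minus its quadratic majorant; the Lipschitz bound makes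
  -- the derivative nonpositive on (0, 1).
  set φ : ℝ → ℝ := fun t => f (x + t • v) - t * inner ℝ (gradient f x) v
    - L / 2 * ‖v‖ ^ 2 * t ^ 2 with hφ
  have hd : ∀ t, HasDerivAt φ (inner ℝ (gradient f (x + t • v)) v - inner ℝ (gradient f x) v
      - L / 2 * ‖v‖ ^ 2 * (2 * t)) t := by
    intro t
    have h1 : HasDerivAt (fun t : ℝ => x + t • v) v t := by
      simpa using ((hasDerivAt_id t).smul_const v).const_add x
    have h2 := (hf (x + t • v)).hasGradientAt.hasFDerivAt.comp_hasDerivAt t h1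
    have h3 : HasDerivAt (fun t : ℝ => t * inner ℝ (gradient f x) v)
        (inner ℝ (gradient f x) v) t := by
      simpa using (hasDerivAt_id t).mul_const (inner ℝ (gradient f x) v)
    have h4 : HasDerivAt (fun t : ℝ => L / 2 * ‖v‖ ^ 2 * t ^ 2) (L / 2 * ‖v‖ ^ 2 * (2 * t)) t := by
      simpa using (hasDerivAt_pow 2 t).const_mul (L / 2 * ‖v‖ ^ 2)
    have h2' : HasDerivAt (fun t : ℝ => f (x + t • v)) (inner ℝ (gradient f (x + t • v)) v) t := h2
    exact (h2'.sub h3).sub h4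
  have hanti : AntitoneOn φ (Set.Icc 0 1) := by
    refine antitoneOn_of_deriv_nonpos (convex_Icc 0 1)
      (fun t _ => (hd t).continuousAt.continuousWithinAt)
      (fun t _ => (hd t).differentiableAt.differentiableWithinAt) fun t ht => ?_
    rw [interior_Icc] at ht
    rw [(hd t).deriv, ← inner_sub_left]
    have h1 := real_inner_le_norm (gradient f (x + t • v) - gradient f x) v
    have h2 := hL (x + t • v) x
    rw [add_sub_cancel_left, norm_smul, Real.norm_of_nonneg ht.1.le] at h2
    nlinarith [norm_nonneg v]
  have h01 := hanti (Set.left_mem_Icc.2 zero_le_one) (Set.right_mem_Icc.2 zero_le_one) zero_le_one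
  simp only [hφ, one_smul, zero_smul, add_zero] at h01
  linarith

/-- A gradient step of length 1/L lowers f by at least ‖∇f‖²/(2L), and f cannot go below 0. This
lets a bound on f(x₀) control the initial gradient. -/
theorem norm_gradient_sq_le (hf : Differentiable ℝ f) (hL0 : 0 < L)
    (hL : ∀ u v, ‖gradient f u - gradient f v‖ ≤ L * ‖u - v‖) (hnn : ∀ x, 0 ≤ f x) (x : E) :
    ‖gradient f x‖ ^ 2 ≤ 2 * L * f x := by
  have h := le_add_inner_gradient_add hf hL x (-(1 / L) • gradient f x)
  have h0 := hnn (x + -(1 / L) • gradient f x)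
  rw [real_inner_smul_right, real_inner_self_eq_norm_sq, norm_smul, mul_pow, norm_neg,
    Real.norm_of_nonneg (by positivity)] at h
  have e : L / 2 * ((1 / L) ^ 2 * ‖gradient f x‖ ^ 2) = 1 / L * ‖gradient f x‖ ^ 2 / 2 := by
    field_simp
  rw [e] at h
  have h2 : 1 / L * ‖gradient f x‖ ^ 2 ≤ 2 * f x := by linarith
  calc ‖gradient f x‖ ^ 2 = L * (1 / L * ‖gradient f x‖ ^ 2) := by field_simp
    _ ≤ L * (2 * f x) := by gcongr
    _ = _ := by ring

end Smooth

/-! ### Inequalities for squared norms -/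

section NormSq

variable {E : Type*} [NormedAddCommGroup E]

theorem norm_add_sq_le_two (a b : E) : ‖a + b‖ ^ 2 ≤ 2 * ‖a‖ ^ 2 + 2 * ‖b‖ ^ 2 := by
  have h := norm_add_le a b
  nlinarith [norm_nonneg (a + b), sq_nonneg (‖a‖ - ‖b‖)]

theorem norm_sub_sq_le_two (a b : E) : ‖a - b‖ ^ 2 ≤ 2 * ‖a‖ ^ 2 + 2 * ‖b‖ ^ 2 := by
  have h := norm_add_sq_le_two a (-b)
  rwa [norm_neg, ← sub_eq_add_neg] at h

theorem norm_add_add_sq_le_three (a b c : E) :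
    ‖a + b + c‖ ^ 2 ≤ 3 * ‖a‖ ^ 2 + 3 * ‖b‖ ^ 2 + 3 * ‖c‖ ^ 2 := by
  have h := norm_add₃_le (a := a) (b := b) (c := c)
  nlinarith [norm_nonneg (a + b + c), sq_nonneg (‖a‖ - ‖b‖), sq_nonneg (‖a‖ - ‖c‖),
    sq_nonneg (‖b‖ - ‖c‖)]

variable [InnerProductSpace ℝ E]

/-- Separates the second difference of the primal iterates into a change of direction and a change
of step size; the latter is of higher order. -/
theorem norm_smul_sub_smul_sq_le (h h' : ℝ) (v v' : E) :
    ‖h • v - h' • v'‖ ^ 2 ≤ 2 * h ^ 2 * ‖v - v'‖ ^ 2 + 2 * (h' - h) ^ 2 * ‖v'‖ ^ 2 := by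
  have e1 : h • v - h' • v' = h • (v - v') - (h' - h) • v' := by
    rw [smul_sub, sub_smul]; abel
  have := norm_sub_sq_le_two (h • (v - v')) ((h' - h) • v')
  rw [← e1, norm_smul, norm_smul, mul_pow, mul_pow, Real.norm_eq_abs, Real.norm_eq_abs, sq_abs,
    sq_abs] at this
  linarith

theorem neg_inner_le_div_add {t : ℝ} (ht : 0 < t) (u v : E) :
    -inner ℝ u v ≤ 1 / (2 * t) * ‖u‖ ^ 2 + t / 2 * ‖v‖ ^ 2 := by
  have k1 := neg_le_of_abs_le (abs_real_inner_le_norm u v)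
  have k2 : 1 / (2 * t) * ‖u‖ ^ 2 + t / 2 * ‖v‖ ^ 2 - ‖u‖ * ‖v‖
      = (‖u‖ - t * ‖v‖) ^ 2 / (2 * t) := by field_simp; ring
  have k3 : 0 ≤ (‖u‖ - t * ‖v‖) ^ 2 / (2 * t) := by positivity
  linarith

end NormSq

/-! ### Deterministic analysis of one iteration -/

section OneStep

variable {E F : Type*} [NormedAddCommGroup E] [InnerProductSpace ℝ E] [CompleteSpace E]
  [NormedAddCommGroup F] [InnerProductSpace ℝ F] [CompleteSpace F]

/-- The augmented Lagrangian of `f` for the constraint `A x = b`. -/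
noncomputable def augLagrangian (f : E → ℝ) (A : E →L[ℝ] F) (b : F) (ρ : ℝ) (x : E) (l : F) : ℝ :=
  f x + inner ℝ l (A x - b) + ρ / 2 * ‖A x - b‖ ^ 2

/-- The direction v is the negative x-gradient of the augmented Lagrangian up to the error g -
∇f(x), and L + ρ‖A‖² bounds the curvature. The last term, ρ times the squared residual, is the exact
gain from the multiplier update and remains to be paid for. -/
theorem augLagrangian_step_le {f : E → ℝ} {L : ℝ} (hf : Differentiable ℝ f)
    (hL : ∀ u v, ‖gradient f u - gradient f v‖ ≤ L * ‖u - v‖) (A : E →L[ℝ] F) (b : F)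
    {ρ : ℝ} (hρ : 0 < ρ) (h : ℝ) (x g : E) (l : F) (v : E)
    (hv : v = -(g + adjoint A l + ρ • adjoint A (A x - b))) :
    augLagrangian f A b ρ (x + h • v) (l + ρ • (A (x + h • v) - b)) ≤
      augLagrangian f A b ρ x l - h * ‖v‖ ^ 2 - h * inner ℝ (g - gradient f x) v
        + (L + ρ * ‖A‖ ^ 2) / 2 * (h ^ 2 * ‖v‖ ^ 2) + ρ * ‖A (x + h • v) - b‖ ^ 2 := by
  have h1 := le_add_inner_gradient_add hf hL x (h • v)
  rw [norm_smul, mul_pow, Real.norm_eq_abs, sq_abs, real_inner_smul_right] at h1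
  set r := A x - b with hr
  have hr' : A (x + h • v) - b = r + h • A v := by
    rw [map_add, map_smul, hr]; abel
  have hAv : ‖A v‖ ^ 2 ≤ ‖A‖ ^ 2 * ‖v‖ ^ 2 := by
    rw [← mul_pow]; gcongr; exact A.le_opNorm v
  have hvv : ‖v‖ ^ 2 = -(inner ℝ g v + inner ℝ l (A v) + ρ * inner ℝ r (A v)) := by
    have hvv' : inner ℝ v v = inner ℝ (-(g + adjoint A l + ρ • adjoint A r)) v := by rw [← hv]
    rw [← real_inner_self_eq_norm_sq, hvv', inner_neg_left, inner_add_left, inner_add_left, real_inner_smul_left,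
      ContinuousLinearMap.adjoint_inner_left, ContinuousLinearMap.adjoint_inner_left]
  unfold augLagrangian
  rw [hr', inner_add_left, real_inner_smul_left, real_inner_self_eq_norm_sq, inner_add_right,
    real_inner_smul_right, norm_add_sq_real, real_inner_smul_right, norm_smul, mul_pow,
    Real.norm_eq_abs, sq_abs, inner_sub_left g, ← hr]
  have h2 : ρ / 2 * (h ^ 2 * ‖A v‖ ^ 2) ≤ ρ / 2 * (h ^ 2 * (‖A‖ ^ 2 * ‖v‖ ^ 2)) := by gcongr
  have h3 : h * ‖v‖ ^ 2 = h * -(inner ℝ g v + inner ℝ l (A v) + ρ * inner ℝ r (A v)) := by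
    rw [← hvv]
  linarith

/-- The difference of two consecutive primal optimality relations. -/
theorem smul_adjoint_residual_eq (A : E →L[ℝ] F) (b : F) {ρ h h' : ℝ} {x' g' g v v' : E} {l' : F}
    (hv' : v' = -(g' + adjoint A l' + ρ • adjoint A (A x' - b)))
    (hv : v = -(g + adjoint A (l' + ρ • (A (x' + h' • v') - b))
      + ρ • adjoint A (A (x' + h' • v') - b))) :
    ρ • adjoint A (A (x' + h' • v' + h • v) - b)
      = -(g - g') - (v - v') + ρ • adjoint A (A (h • v - h' • v')) := by
  -- With r₀, r₁ the residuals at the first two points, the multiplier update makes the difference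
  -- of the two relations contain 2r₁ - r₀. This linear extrapolation is the next residual up to A
  -- applied to the second difference.
  have e : A (x' + h' • v' + h • v) - b
      = (A (x' + h' • v') - b) + (A (x' + h' • v') - b) - (A x' - b)
        + A (h • v - h' • v') := by
    simp only [map_add, map_sub]; abel
  rw [e]
  simp only [map_add, map_sub, map_smul] at hv hv' ⊢
  have h1 : g = -v - (adjoint A l' + ρ • (adjoint A (A x') + h' • adjoint A (A v') - adjoint A b)
      + ρ • (adjoint A (A x') + h' • adjoint A (A v') - adjoint A b)) := by
    rw [hv]; abel
  have h2 : g' = -v' - (adjoint A l' + ρ • (adjoint A (A x') - adjoint A b)) := by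
    rw [hv']; abel
  rw [h1, h2]
  simp only [smul_add, smul_sub]
  abel

/-- The part of the potential that does not involve the gradient error. -/
noncomputable def potential (f : E → ℝ) (A : E →L[ℝ] F) (b : F) (ρ m h : ℝ) (x : E) (l : F)
    (v : E) : ℝ :=
  augLagrangian f A b ρ x l + m / h * (ρ / 2) * ‖A x - b‖ ^ 2 + m / 2 * ‖v‖ ^ 2

/-- The primal optimality relations tested against the step. -/
theorem cross_term_eq (A : E →L[ℝ] F) {ρ h h' : ℝ} {v v' Δ : E} {r : F}
    (hkey : ρ • adjoint A (r + h • A v)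
      = -Δ - (v - v') + ρ • adjoint A (A (h • v - h' • v'))) :
    ρ / 2 * (‖r + h • A v‖ ^ 2 - ‖r‖ ^ 2) + h / 2 * (‖v‖ ^ 2 - ‖v'‖ ^ 2 + ‖v - v'‖ ^ 2)
      + h * inner ℝ Δ v + ρ / 2 * (‖A (h' • v')‖ ^ 2 - ‖A (h • v - h' • v')‖ ^ 2) = 0 := by
  set y := h • v - h' • v' with hy
  set w := v - v' with hw
  set r₁ := r + h • A v with hr₁
  -- The relation tested against h • v; the polarization identities `i2`, `i3`, `i4` then turn its
  -- inner products into differences of squares.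
  have i1 : ρ * inner ℝ r₁ (A (h • v)) = -(h * inner ℝ Δ v) - h * inner ℝ w v
      + ρ * inner ℝ (A y) (A (h • v)) := by
    have := congrArg (fun z => inner ℝ z (h • v)) hkey
    simp only [real_inner_smul_left, inner_add_left, inner_sub_left (-Δ), inner_neg_left,
      ContinuousLinearMap.adjoint_inner_left] at this
    rw [this]
    simp only [real_inner_smul_right]
  have i2 : ‖r‖ ^ 2 = ‖r₁‖ ^ 2 - 2 * inner ℝ r₁ (A (h • v)) + ‖A (h • v)‖ ^ 2 := by
    rw [← norm_sub_sq_real, map_smul, hr₁, add_sub_cancel_right]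
  have i3 : ‖v'‖ ^ 2 = ‖v‖ ^ 2 - 2 * inner ℝ w v + ‖w‖ ^ 2 := by
    rw [real_inner_comm, ← norm_sub_sq_real, hw, sub_sub_cancel]
  have i4 : ‖A (h' • v')‖ ^ 2 = ‖A (h • v)‖ ^ 2 - 2 * inner ℝ (A y) (A (h • v)) + ‖A y‖ ^ 2 := by
    rw [real_inner_comm, ← norm_sub_sq_real, ← map_sub, hy, sub_sub_cancel]
  rw [i2, i3, i4]
  linarith

/-- The dual step is controlled by the primal one through the spectral gap. -/
theorem dual_step_le (A : E →L[ℝ] F) {ρ δ : ℝ} (hρ : 0 < ρ) {w y Δ : E} {r₁ : F}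
    (hkey : ρ • adjoint A r₁ = -Δ - w + ρ • adjoint A (A y))
    (hgap : δ * ‖r₁‖ ^ 2 ≤ ‖adjoint A r₁‖ ^ 2) :
    δ * (ρ ^ 2 * ‖r₁‖ ^ 2)
      ≤ 2 * ‖w‖ ^ 2 + 4 * ‖Δ‖ ^ 2 + 4 * (ρ * ‖A‖ ^ 2) ^ 2 * ‖y‖ ^ 2 := by
  have j1 : ρ ^ 2 * ‖adjoint A r₁‖ ^ 2 = ‖-Δ - w + ρ • adjoint A (A y)‖ ^ 2 := by
    rw [← hkey, norm_smul, mul_pow, Real.norm_eq_abs, sq_abs]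
  have j2 : ‖ρ • adjoint A (A y)‖ ^ 2 ≤ (ρ * ‖A‖ ^ 2) ^ 2 * ‖y‖ ^ 2 := by
    rw [← mul_pow, norm_smul, Real.norm_of_nonneg hρ.le]
    have k1 := (adjoint A).le_opNorm (A y)
    have k2 := A.le_opNorm y
    rw [LinearIsometryEquiv.norm_map] at k1
    refine pow_le_pow_left₀ (by positivity) ?_ 2
    calc ρ * ‖adjoint A (A y)‖ ≤ ρ * (‖A‖ * (‖A‖ * ‖y‖)) :=
          mul_le_mul_of_nonneg_left (k1.trans (mul_le_mul_of_nonneg_left k2 (norm_nonneg A))) hρ.le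
      _ = ρ * ‖A‖ ^ 2 * ‖y‖ := by ring
  have j3 : ‖-Δ - w + ρ • adjoint A (A y)‖ ^ 2
      ≤ 2 * ‖w‖ ^ 2 + 2 * ‖-Δ + ρ • adjoint A (A y)‖ ^ 2 := by
    have := norm_add_sq_le_two (-w) (-Δ + ρ • adjoint A (A y))
    rw [norm_neg] at this
    convert this using 3
    abel
  have j4 := norm_add_sq_le_two (-Δ) (ρ • adjoint A (A y))
  rw [norm_neg] at j4
  have j5 := mul_le_mul_of_nonneg_left hgap (sq_nonneg ρ)
  linarith

/-- Multiply the growth bound by h h'; 109 rounds up (9/10)·121. -/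
theorem sub_le_of_inv_sub_inv_le {L h h' : ℝ} (h0 : 0 < h) (h'0 : 0 < h')
    (hgrow : 1 / h - 1 / h' ≤ 9 / 10 * (121 * L ^ 2) * h) :
    h' - h ≤ 109 * L ^ 2 * (h ^ 2 * h') := by
  have k1 : h' - h = (1 / h - 1 / h') * (h * h') := by field_simp
  have k2 : (1 / h - 1 / h') * (h * h') ≤ 9 / 10 * (121 * L ^ 2) * h * (h * h') := by gcongr
  have k3 : 0 ≤ L ^ 2 * (h ^ 2 * h') := by positivity
  rw [k1]; nlinarith

/-- The coefficient of the second difference of the primal iterates. -/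
theorem second_difference_le {L ρ η m h h' a W V Y : ℝ} (hL0 : 0 < L) (hρ : 0 < ρ) (hη : 0 < η)
    (hm : 0 < m) (ha0 : 0 ≤ a) (hmL : m * L ≤ 1 / 448) (hηA : η * (L + ρ * a) = 1 / 11)
    (h0 : 0 < h) (hh' : h ≤ h') (hη' : h' ≤ η / 100)
    (hgrow : 1 / h - 1 / h' ≤ 9 / 10 * (121 * L ^ 2) * h) (hW : 0 ≤ W) (hV : 0 ≤ V) (hY : 0 ≤ Y)
    (hyn : Y ≤ 2 * h ^ 2 * W + 2 * (h' - h) ^ 2 * V) :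
    (m / h * (ρ / 2) * a + 3 / 20 * m * (4 * (ρ * a) ^ 2)) * Y
      ≤ 1 / 1000 * (m * W) + 1 / 1000 * (h' * V) := by
  have hLη : L * η ≤ 1 / 11 := by nlinarith [mul_nonneg hη.le (mul_nonneg hρ.le ha0)]
  have hρA : ρ * a * η ≤ 1 / 11 := by nlinarith [mul_pos hη hL0]
  have h'0 : 0 < h' := h0.trans_le hh'
  have hLh : L * h ≤ 1 / 1100 := by nlinarith
  have hdiff := sub_le_of_inv_sub_inv_le h0 h'0 hgrow
  have hhη : h / η ≤ 1 / 100 := by rw [div_le_iff₀ hη]; linarith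
  have hhη' : h' / η ≤ 1 / 100 := by rw [div_le_iff₀ hη]; linarith
  have k0 : ρ * a ≤ 1 / (11 * η) := by
    rw [le_div_iff₀ (by positivity)]; linarith
  have k1 : m / h * (ρ / 2) * a + 3 / 20 * m * (4 * (ρ * a) ^ 2) ≤ m / (20 * η * h) := by
    calc m / h * (ρ / 2) * a + 3 / 20 * m * (4 * (ρ * a) ^ 2)
        = m / (2 * h) * (ρ * a) + 3 / 5 * m * (ρ * a) ^ 2 := by field_simp; ring
      _ ≤ m / (2 * h) * (1 / (11 * η)) + 3 / 5 * m * (1 / (11 * η)) ^ 2 := by gcongr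
      _ = m / (η * h) * (1 / 22 + 3 / 605 * (h / η)) := by field_simp; ring
      _ ≤ m / (η * h) * (1 / 20) := by
          gcongr; linarith
      _ = _ := by field_simp
  have hw1 : m / (20 * η * h) * (2 * h ^ 2 * W) ≤ 1 / 1000 * (m * W) := by
    calc _ = 1 / 10 * (h / η) * (m * W) := by field_simp; ring
      _ ≤ 1 / 10 * (1 / 100) * (m * W) := by gcongr
      _ = _ := by ring
  have hv1 : m / (20 * η * h) * (2 * (h' - h) ^ 2 * V) ≤ 1 / 1000 * (h' * V) := by
    have q1 : (h' - h) ^ 2 ≤ (109 * L ^ 2 * (h ^ 2 * h')) ^ 2 :=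
      pow_le_pow_left₀ (by linarith) hdiff 2
    calc _ ≤ m / (20 * η * h) * (2 * (109 * L ^ 2 * (h ^ 2 * h')) ^ 2 * V) := by gcongr
      _ = 11881 / 10 * (m * L) * (L * h) ^ 3 * (h' / η) * (h' * V) := by
          field_simp; ring
      _ ≤ 11881 / 10 * (1 / 448) * (1 / 1100) ^ 3 * (1 / 100) * (h' * V) := by gcongr
      _ ≤ 1 / 1000 * (h' * V) := by
          refine mul_le_mul_of_nonneg_right (by norm_num) (by positivity)
  calc _ ≤ m / (20 * η * h) * (2 * h ^ 2 * W + 2 * (h' - h) ^ 2 * V) :=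
        mul_le_mul k1 hyn hY (by positivity)
    _ = m / (20 * η * h) * (2 * h ^ 2 * W) + m / (20 * η * h) * (2 * (h' - h) ^ 2 * V) := by ring
    _ ≤ _ := add_le_add hw1 hv1

/-- The change of the potential along one iteration, for every realization of the samples. -/
theorem potential_step_le {f : E → ℝ} {L : ℝ} (hf : Differentiable ℝ f)
    (hL : ∀ u v, ‖gradient f u - gradient f v‖ ≤ L * ‖u - v‖) (A : E →L[ℝ] F) (b : F)
    {ρ δ η m h h' h'' : ℝ} (hL0 : 0 < L) (hρ : 0 < ρ) (hη : 0 < η) (hm : 0 < m)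
    (hmL : m * L ≤ 1 / 448) (hρδ : 7 ≤ ρ * δ * m) (hηA : η * (L + ρ * ‖A‖ ^ 2) = 1 / 11)
    (h0 : 0 < h) (hh' : h ≤ h') (hη' : h' ≤ η / 100)
    (hgrow : 1 / h - 1 / h' ≤ 9 / 10 * (121 * L ^ 2) * h)
    (hgrow' : m * (1 / h'' - 1 / h) ≤ 1 / 10)
    {x' g' g v v' : E} {l' : F}
    (hv' : v' = -(g' + adjoint A l' + ρ • adjoint A (A x' - b)))
    (hv : v = -(g + adjoint A (l' + ρ • (A (x' + h' • v') - b))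
      + ρ • adjoint A (A (x' + h' • v') - b)))
    (hgap : δ * ‖A (x' + h' • v' + h • v) - b‖ ^ 2
      ≤ ‖adjoint A (A (x' + h' • v' + h • v) - b)‖ ^ 2) :
    potential f A b ρ m h'' (x' + h' • v' + h • v)
        (l' + ρ • (A (x' + h' • v') - b) + ρ • (A (x' + h' • v' + h • v) - b)) v ≤
      potential f A b ρ m h (x' + h' • v') (l' + ρ • (A (x' + h' • v') - b)) v'
        - 7 / 10 * h * ‖v‖ ^ 2 + h * ‖g - gradient f (x' + h' • v')‖ ^ 2
        + 1 / 1000 * h' * ‖v'‖ ^ 2 + m / (L * h) * ‖g - g'‖ ^ 2 := by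
  have hdesc := augLagrangian_step_le hf hL A b hρ h (x' + h' • v') g
    (l' + ρ • (A (x' + h' • v') - b)) v hv
  have hkey := smul_adjoint_residual_eq A b (h := h) hv' hv
  have h'0 : 0 < h' := h0.trans_le hh'
  have hr₁ : A (x' + h' • v' + h • v) - b = (A (x' + h' • v') - b) + h • A v := by
    rw [map_add, map_smul]; abel
  unfold potential
  rw [hr₁] at hgap hkey hdesc ⊢
  have hid := cross_term_eq A hkey
  have hdual := dual_step_le A hρ hkey hgap
  have hyn := norm_smul_sub_smul_sq_le h h' v v'
  have hAy : ‖A (h • v - h' • v')‖ ^ 2 ≤ ‖A‖ ^ 2 * ‖h • v - h' • v'‖ ^ 2 := by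
    rw [← mul_pow]; exact pow_le_pow_left₀ (norm_nonneg _) (A.le_opNorm _) 2
  have hsd := second_difference_le hL0 hρ hη hm (sq_nonneg ‖A‖) hmL hηA h0 hh' hη' hgrow
    (sq_nonneg ‖v - v'‖) (sq_nonneg ‖v'‖) (sq_nonneg ‖h • v - h' • v'‖) hyn
  -- With t = 1/2 the gradient error enters with coefficient 1 and a quarter of h‖v‖² is spent. This
  -- leaves 3/4, of which 1/20 covers the remaining costs.
  have hyoung₁ := neg_inner_le_div_add (show (0 : ℝ) < 1 / 2 by norm_num)
    (g - gradient f (x' + h' • v')) v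
  have hLh0 : 0 < L * h := mul_pos hL0 h0
  -- The parameter t = Lh puts the cost mLh/2 on ‖v‖², which is negligible against h since mL ≤
  -- 1/448.
  have hyoung₂ := neg_inner_le_div_add hLh0 (g - g') v
  have hrpos : 0 ≤ ‖A (x' + h' • v') - b + h • A v‖ ^ 2 := sq_nonneg _
  have hAv' : 0 ≤ ‖A (h' • v')‖ ^ 2 := sq_nonneg _
  have hV : 0 ≤ ‖v‖ ^ 2 := sq_nonneg _
  have hW : 0 ≤ ‖v - v'‖ ^ 2 := sq_nonneg _
  have hD : 0 ≤ ‖g - g'‖ ^ 2 := sq_nonneg _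
  have ha0 : 0 ≤ ‖A‖ ^ 2 := sq_nonneg _
  generalize augLagrangian f A b ρ (x' + h' • v' + h • v) _ = Lag₁ at hdesc ⊢
  generalize augLagrangian f A b ρ (x' + h' • v') _ = Lag₀ at hdesc ⊢
  generalize ‖A (x' + h' • v') - b + h • A v‖ ^ 2 = R₁ at *
  generalize ‖A (x' + h' • v') - b‖ ^ 2 = R₀ at *
  generalize inner ℝ (g - gradient f (x' + h' • v')) v = ie at *
  generalize ‖g - gradient f (x' + h' • v')‖ ^ 2 = N at *
  generalize inner ℝ (g - g') v = iD at *
  generalize ‖A (h' • v')‖ ^ 2 = AV at *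
  generalize ‖A (h • v - h' • v')‖ ^ 2 = AY at *
  generalize ‖h • v - h' • v'‖ ^ 2 = Y at *
  generalize ‖v - v'‖ ^ 2 = W at *
  generalize ‖g - g'‖ ^ 2 = D at *
  generalize ‖v‖ ^ 2 = Q at *
  generalize ‖v'‖ ^ 2 = Q' at *
  generalize ‖A‖ ^ 2 = a at *
  clear hL hf hkey hgap hr₁ hv hv'
  have hLη : L * η ≤ 1 / 11 := by
    have := mul_nonneg hη.le (mul_nonneg hρ.le ha0)
    linarith
  have hLh : L * h ≤ 1 / 1100 := by
    have := mul_le_mul_of_nonneg_left (hh'.trans hη') hL0.le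
    linarith
  -- 3/20 = (21/20)·(1/7): the growth of m/h adds at most ρ/20 to the coefficient ρ, and 7 ≤ ρδm
  -- allows division by the spectral gap.
  have hβ : (ρ + m * (1 / h'' - 1 / h) * (ρ / 2)) * R₁
      ≤ 3 / 20 * m * (2 * W + 4 * D + 4 * (ρ * a) ^ 2 * Y) := by
    have k1 : (ρ + m * (1 / h'' - 1 / h) * (ρ / 2)) * R₁ ≤ 21 / 20 * ρ * R₁ := by
      refine mul_le_mul_of_nonneg_right ?_ hrpos
      have := mul_le_mul_of_nonneg_right hgrow' (half_pos hρ).le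
      linarith
    have k2 := mul_le_mul_of_nonneg_right hρδ (mul_nonneg hρ.le hrpos)
    have k3 := mul_le_mul_of_nonneg_left hdual hm.le
    linarith
  have hΔc : (m / (2 * (L * h)) + 3 / 5 * m) * D ≤ m / (L * h) * D := by
    refine mul_le_mul_of_nonneg_right ?_ hD
    have k : m / (L * h) = m * (1 / (L * h)) := by ring
    have k' : m / (2 * (L * h)) = m * (1 / (L * h)) / 2 := by field_simp
    have k2 : 2 ≤ 1 / (L * h) := by
      rw [le_div_iff₀ hLh0]; linarith
    rw [k, k']
    have := mul_le_mul_of_nonneg_left k2 hm.le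
    linarith
  have hvn : 0 ≤ h * Q := mul_nonneg h0.le hV
  have hvc : m * (L * h / 2 * Q) ≤ 1 / 800 * (h * Q) := by
    have := mul_le_mul_of_nonneg_right hmL hvn
    linarith
  have hLc : (L + ρ * a) / 2 * (h ^ 2 * Q) ≤ 1 / 1000 * (h * Q) := by
    have q : (L + ρ * a) * h ≤ 1 / 1100 := by
      have := mul_le_mul_of_nonneg_left (hh'.trans hη') (show 0 ≤ L + ρ * a by positivity)
      linarith
    have := mul_le_mul_of_nonneg_right q hvn
    linarith
  -- Scaled by m/h, the cross-term identity supplies -(m/2)W. It pays for the (3/10)mW of the dual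
  -- step and the (1/1000)mW of the second difference.
  have hid' : m / h * (ρ / 2) * (R₁ - R₀) + m / 2 * (Q - Q')
      = - (m / 2 * W) + m * (-iD) - m / h * (ρ / 2) * AV + m / h * (ρ / 2) * AY := by
    have c1 : m / h * h = m := by field_simp
    linear_combination (m / h) * hid - (1 / 2 * (Q - Q' + W) + iD) * c1
  have hdrop : 0 ≤ m / h * (ρ / 2) * AV := by positivity
  have hAy' : m / h * (ρ / 2) * AY ≤ m / h * (ρ / 2) * (a * Y) := by gcongr
  have hin := mul_le_mul_of_nonneg_left hyoung₂ hm.le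
  have hin₁ := mul_le_mul_of_nonneg_left hyoung₁ h0.le
  have hsplit : m / h'' * (ρ / 2) * R₁
      = m / h * (ρ / 2) * R₁ + m * (1 / h'' - 1 / h) * (ρ / 2) * R₁ := by ring
  have hc : m * (1 / (2 * (L * h)) * D) = m / (2 * (L * h)) * D := by ring
  have hw0 : 0 ≤ m * W := mul_nonneg hm.le hW
  clear hid hdual hyn hgrow hgrow' hηA hρδ
  linarith

end OneStep

/-! ### Integrating out a fresh sample -/

section Conditioning

variable {S Ξ Ω : Type*} [MeasurableSpace S] [MeasurableSpace Ξ] [MeasurableSpace Ω]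
  {P : Measure Ξ} [IsProbabilityMeasure P] {μ : Measure Ω} [IsProbabilityMeasure μ]

/-- A bound on the expectation over a fresh sample, for each fixed state, gives a bound for a random
state that is independent of the sample. -/
theorem integrable_and_integral_le_of_indepFun {T : Ω → S} {X : Ω → Ξ} (hT : Measurable T)
    (hX : MeasurePreserving X μ P) (hTX : IndepFun T X μ) {φ : S × Ξ → ℝ} (hφ : Measurable φ)
    (hφ0 : ∀ z, 0 ≤ φ z) {B : S → ℝ} (hB : Measurable B)
    (hint : ∀ s, Integrable (fun ξ => φ (s, ξ)) P) (hle : ∀ s, ∫ ξ, φ (s, ξ) ∂P ≤ B s)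
    (hBT : Integrable (fun ω => B (T ω)) μ) :
    Integrable (fun ω => φ (T ω, X ω)) μ ∧ ∫ ω, φ (T ω, X ω) ∂μ ≤ ∫ ω, B (T ω) ∂μ := by
  have hmap : μ.map (fun ω => (T ω, X ω)) = (μ.map T).prod P := by
    rw [(indepFun_iff_map_prod_eq_prod_map_map hT.aemeasurable hX.measurable.aemeasurable).1 hTX,
      hX.map_eq]
  have : IsProbabilityMeasure (μ.map T) := Measure.isProbabilityMeasure_map hT.aemeasurable
  have hTXm : Measurable fun ω => (T ω, X ω) := hT.prodMk hX.measurable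
  have hBT' : Integrable B (μ.map T) :=
    (integrable_map_measure hB.aestronglyMeasurable hT.aemeasurable).2 hBT
  have hprod : Integrable φ ((μ.map T).prod P) := by
    rw [integrable_prod_iff hφ.aestronglyMeasurable]
    refine ⟨Filter.Eventually.of_forall hint, hBT'.mono' ?_ ?_⟩
    · exact (hφ.norm.stronglyMeasurable.integral_prod_right').aestronglyMeasurable
    · refine Filter.Eventually.of_forall fun s => ?_
      have h1 : ∫ ξ, ‖φ (s, ξ)‖ ∂P = ∫ ξ, φ (s, ξ) ∂P := by
        simp_rw [Real.norm_of_nonneg (hφ0 _)]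
      rw [h1, Real.norm_of_nonneg (integral_nonneg fun ξ => hφ0 _)]
      exact hle s
  constructor
  · rw [← hmap] at hprod
    exact (integrable_map_measure hφ.aestronglyMeasurable hTXm.aemeasurable).1 hprod
  · have h1 : ∫ ω, φ (T ω, X ω) ∂μ = ∫ s, ∫ ξ, φ (s, ξ) ∂P ∂(μ.map T) := by
      rw [← integral_prod φ hprod, ← hmap,
        integral_map hTXm.aemeasurable hφ.aestronglyMeasurable]
    rw [h1, ← integral_map hT.aemeasurable hB.aestronglyMeasurable]
    exact integral_mono hprod.integral_prod_left hBT' hle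

end Conditioning

/-! ### Second moments of vector-valued random variables -/

section SecondMoment

variable {E : Type*} [NormedAddCommGroup E] [InnerProductSpace ℝ E]
  {Ξ : Type*} [MeasurableSpace Ξ] {P : Measure Ξ}

theorem integral_norm_smul_add_smul_sq_le {D N : Ξ → E} (hD : MemLp D 2 P) (hN : MemLp N 2 P)
    (s t : ℝ) : ∫ ξ, ‖s • D ξ + t • N ξ‖ ^ 2 ∂P
      ≤ 2 * s ^ 2 * ∫ ξ, ‖D ξ‖ ^ 2 ∂P + 2 * t ^ 2 * ∫ ξ, ‖N ξ‖ ^ 2 ∂P := by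
  have hD2 : Integrable (fun ξ => ‖D ξ‖ ^ 2) P := hD.integrable_norm_pow (by norm_num)
  have hN2 : Integrable (fun ξ => ‖N ξ‖ ^ 2) P := hN.integrable_norm_pow (by norm_num)
  have hZ : MemLp (fun ξ => s • D ξ + t • N ξ) 2 P := (hD.const_smul s).add (hN.const_smul t)
  rw [← integral_const_mul, ← integral_const_mul,
    ← integral_add (hD2.const_mul _) (hN2.const_mul _)]
  refine integral_mono (hZ.integrable_norm_pow (by norm_num))
    ((hD2.const_mul _).add (hN2.const_mul _)) fun ξ => ?_
  have := norm_add_sq_le_two (s • D ξ) (t • N ξ)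
  rw [norm_smul, norm_smul, mul_pow, mul_pow, Real.norm_eq_abs, Real.norm_eq_abs, sq_abs,
    sq_abs] at this
  simp only
  linarith

variable [IsProbabilityMeasure P]

theorem integral_smul_add_smul_eq_zero {D N : Ξ → E} (hD : MemLp D 2 P) (hN : MemLp N 2 P)
    (hD0 : ∫ ξ, D ξ ∂P = 0) (hN0 : ∫ ξ, N ξ ∂P = 0) (s t : ℝ) :
    ∫ ξ, (s • D ξ + t • N ξ) ∂P = 0 := by
  have h1 : Integrable (fun ξ => s • D ξ) P := (hD.integrable (by norm_num)).smul s
  have h2 : Integrable (fun ξ => t • N ξ) P := (hN.integrable (by norm_num)).smul t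
  rw [integral_add h1 h2, integral_smul, integral_smul, hD0, hN0, smul_zero, smul_zero, add_zero]

variable [CompleteSpace E]

theorem integral_norm_add_sq {Z : Ξ → E} (hZ : MemLp Z 2 P) (a : E) :
    ∫ ξ, ‖a + Z ξ‖ ^ 2 ∂P = ‖a‖ ^ 2 + 2 * inner ℝ a (∫ ξ, Z ξ ∂P) + ∫ ξ, ‖Z ξ‖ ^ 2 ∂P := by
  have hZi : Integrable Z P := hZ.integrable (by norm_num)
  have hZ2 : Integrable (fun ξ => ‖Z ξ‖ ^ 2) P := hZ.integrable_norm_pow (by norm_num)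
  have hin : Integrable (fun ξ => inner ℝ a (Z ξ)) P := hZi.const_inner a
  simp_rw [norm_add_sq_real]
  have hadd : Integrable (fun ξ => ‖a‖ ^ 2 + 2 * inner ℝ a (Z ξ)) P :=
    (integrable_const _).add (hin.const_mul 2)
  rw [integral_add hadd hZ2,
    integral_add (integrable_const _) (hin.const_mul 2), integral_const_mul, integral_inner hZi]
  simp

theorem norm_integral_sq_le {Z : Ξ → E} (hZ : MemLp Z 2 P) :
    ‖∫ ξ, Z ξ ∂P‖ ^ 2 ≤ ∫ ξ, ‖Z ξ‖ ^ 2 ∂P := by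
  have h := integral_norm_add_sq hZ (-∫ ξ, Z ξ ∂P)
  have h0 : 0 ≤ ∫ ξ, ‖(-∫ ξ, Z ξ ∂P) + Z ξ‖ ^ 2 ∂P := integral_nonneg fun ξ => by positivity
  rw [norm_neg, inner_neg_left, real_inner_self_eq_norm_sq] at h
  linarith

theorem integral_norm_sub_integral_sq_le {Z : Ξ → E} (hZ : MemLp Z 2 P) :
    ∫ ξ, ‖Z ξ - ∫ ζ, Z ζ ∂P‖ ^ 2 ∂P ≤ ∫ ξ, ‖Z ξ‖ ^ 2 ∂P := by
  have h := integral_norm_add_sq hZ (-∫ ξ, Z ξ ∂P)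
  rw [norm_neg, inner_neg_left, real_inner_self_eq_norm_sq] at h
  have e : ∀ ξ, Z ξ - ∫ ζ, Z ζ ∂P = (-∫ ζ, Z ζ ∂P) + Z ξ := fun ξ => by abel
  simp_rw [e]
  nlinarith [sq_nonneg ‖∫ ξ, Z ξ ∂P‖]

end SecondMoment

/-! ### Mean square bounds for the gradient estimate -/

namespace OracleAssumptions

variable {d : ℕ} {Ξ : Type*} [MeasurableSpace Ξ] {P : Measure Ξ}
  {f : EuclideanSpace ℝ (Fin d) → ℝ}
  {G : EuclideanSpace ℝ (Fin d) → Ξ → EuclideanSpace ℝ (Fin d)} {L V : ℝ}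

theorem measurable_apply (h : OracleAssumptions P f G L V) (x : EuclideanSpace ℝ (Fin d)) :
    Measurable (G x) :=
  h.measurable.comp measurable_prodMk_left

theorem memLp_sub (h : OracleAssumptions P f G L V) (u v : EuclideanSpace ℝ (Fin d)) :
    MemLp (fun ξ => G u ξ - G v ξ) 2 P :=
  (memLp_two_iff_integrable_sq_norm
    ((h.measurable_apply u).sub (h.measurable_apply v)).aestronglyMeasurable).2
    (h.integrable_sq_sub u v)

theorem memLp_error (h : OracleAssumptions P f G L V) (x : EuclideanSpace ℝ (Fin d)) :
    MemLp (fun ξ => G x ξ - gradient f x) 2 P :=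
  (memLp_two_iff_integrable_sq_norm
    ((h.measurable_apply x).sub_const _).aestronglyMeasurable).2 (h.integrable_sq_error x)

theorem integral_sub (h : OracleAssumptions P f G L V) (u v : EuclideanSpace ℝ (Fin d)) :
    ∫ ξ, (G u ξ - G v ξ) ∂P = gradient f u - gradient f v := by
  rw [MeasureTheory.integral_sub (h.integrable u) (h.integrable v), h.unbiased, h.unbiased]

variable [IsProbabilityMeasure P]

/-- Jensen: the mean-square Lipschitz bound on the oracle passes to its mean, so smoothness of f
follows from the oracle assumptions. -/
theorem gradient_lipschitz (h : OracleAssumptions P f G L V) (hL : 0 < L)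
    (u v : EuclideanSpace ℝ (Fin d)) :
    ‖gradient f u - gradient f v‖ ≤ L * ‖u - v‖ := by
  have h1 := norm_integral_sq_le (h.memLp_sub u v)
  rw [h.integral_sub] at h1
  have h2 := h1.trans (h.mean_square_smooth u v)
  rw [← mul_pow] at h2
  exact le_of_sq_le_sq h2 (by positivity)

theorem continuous_gradient (h : OracleAssumptions P f G L V) (hL : 0 < L) :
    Continuous (gradient f) :=
  (LipschitzWith.of_dist_le_mul (K := ⟨L, hL.le⟩) fun u v => by
    rw [dist_eq_norm, dist_eq_norm]; exact h.gradient_lipschitz hL u v).continuous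

/-- The recursion for the mean square error of the gradient estimate, over one fresh sample. -/
theorem estimator_error (h : OracleAssumptions P f G L V) {α : ℝ} (hα0 : 0 ≤ α) (hα1 : α ≤ 1)
    (x y g : EuclideanSpace ℝ (Fin d)) :
    Integrable (fun ξ => ‖G y ξ + (1 - α) • (g - G x ξ) - gradient f y‖ ^ 2) P ∧
    ∫ ξ, ‖G y ξ + (1 - α) • (g - G x ξ) - gradient f y‖ ^ 2 ∂P ≤
      (1 - α) * ‖g - gradient f x‖ ^ 2 + 2 * L ^ 2 * ‖y - x‖ ^ 2 + 2 * α ^ 2 * V ^ 2 := by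
  have hDm : MemLp (fun ξ => G y ξ - G x ξ - (gradient f y - gradient f x)) 2 P :=
    (h.memLp_sub y x).sub (memLp_const _)
  have hNm := h.memLp_error y
  have hDi : ∫ ξ, (G y ξ - G x ξ - (gradient f y - gradient f x)) ∂P = 0 := by
    have hi : Integrable (fun ξ => G y ξ - G x ξ) P := (h.integrable y).sub (h.integrable x)
    rw [MeasureTheory.integral_sub hi (integrable_const _), h.integral_sub]
    simp
  have hNi : ∫ ξ, (G y ξ - gradient f y) ∂P = 0 := by
    rw [MeasureTheory.integral_sub (h.integrable y) (integrable_const _), h.unbiased]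
    simp
  have hD2 : ∫ ξ, ‖G y ξ - G x ξ - (gradient f y - gradient f x)‖ ^ 2 ∂P
      ≤ L ^ 2 * ‖y - x‖ ^ 2 := by
    have := integral_norm_sub_integral_sq_le (h.memLp_sub y x)
    rw [h.integral_sub] at this
    exact this.trans (h.mean_square_smooth y x)
  have hN2 := h.variance_le y
  have hZi := integral_smul_add_smul_eq_zero hDm hNm hDi hNi (1 - α) α
  have hZ2 := integral_norm_smul_add_smul_sq_le hDm hNm (1 - α) α
  have hZm : MemLp (fun ξ => (1 - α) • (G y ξ - G x ξ - (gradient f y - gradient f x))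
      + α • (G y ξ - gradient f y)) 2 P := (hDm.const_smul (1 - α)).add (hNm.const_smul α)
  -- The old error shrunk by 1 - α, plus a centred fluctuation; the cross term has mean zero, which
  -- is why no constant multiplies the old error.
  have e : ∀ ξ, G y ξ + (1 - α) • (g - G x ξ) - gradient f y
      = (1 - α) • (g - gradient f x) + ((1 - α) • (G y ξ - G x ξ - (gradient f y - gradient f x))
      + α • (G y ξ - gradient f y)) := fun ξ => by
    module
  have hm : MemLp (fun ξ => G y ξ + (1 - α) • (g - G x ξ) - gradient f y) 2 P := by
    have hc : MemLp (fun _ : Ξ => (1 - α) • (g - gradient f x)) 2 P := memLp_const _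
    simp_rw [e]
    exact hc.add hZm
  refine ⟨hm.integrable_norm_pow (by norm_num), ?_⟩
  simp_rw [e]
  rw [integral_norm_add_sq hZm, hZi, inner_zero_right, norm_smul, mul_pow, Real.norm_eq_abs, sq_abs]
  have q1 : (1 - α) ^ 2 ≤ 1 - α := by nlinarith
  have q2 : (1 - α) ^ 2 ≤ 1 := by nlinarith
  have t1 := mul_le_mul_of_nonneg_right q1 (sq_nonneg ‖g - gradient f x‖)
  have t2 := mul_le_mul_of_nonneg_right q2 (show 0 ≤ L ^ 2 * ‖y - x‖ ^ 2 by positivity)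
  have t3 := mul_le_mul_of_nonneg_left hD2 (show 0 ≤ 2 * (1 - α) ^ 2 by positivity)
  have t4 := mul_le_mul_of_nonneg_left hN2 (show 0 ≤ 2 * α ^ 2 by positivity)
  linarith

/-- The mean square change of the gradient estimate, over one fresh sample. -/
theorem estimator_change (h : OracleAssumptions P f G L V) (α : ℝ)
    (x y g : EuclideanSpace ℝ (Fin d)) :
    Integrable (fun ξ => ‖G y ξ + (1 - α) • (g - G x ξ) - g‖ ^ 2) P ∧
    ∫ ξ, ‖G y ξ + (1 - α) • (g - G x ξ) - g‖ ^ 2 ∂P ≤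
      3 * L ^ 2 * ‖y - x‖ ^ 2 + 3 * α ^ 2 * ‖g - gradient f x‖ ^ 2 + 3 * α ^ 2 * V ^ 2 := by
  have hDm := h.memLp_sub y x
  have hNm := h.memLp_error x
  -- Arranged so that the old error and the noise at x both carry a factor α, while the oracle
  -- difference is controlled by ‖y - x‖.
  have e : ∀ ξ, G y ξ + (1 - α) • (g - G x ξ) - g
      = (G y ξ - G x ξ) + (-α) • (g - gradient f x) + α • (G x ξ - gradient f x) := fun ξ => by
    module
  have hm : MemLp (fun ξ => G y ξ + (1 - α) • (g - G x ξ) - g) 2 P := by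
    simp_rw [e]
    exact (hDm.add (memLp_const _)).add (hNm.const_smul α)
  have hi : Integrable (fun ξ => ‖G y ξ + (1 - α) • (g - G x ξ) - g‖ ^ 2) P :=
    hm.integrable_norm_pow (by norm_num)
  refine ⟨hi, ?_⟩
  have hDi := (h.integrable_sq_sub y x).const_mul 3
  have hNi := (h.integrable_sq_error x).const_mul (3 * α ^ 2)
  calc _ ≤ ∫ ξ, (3 * ‖G y ξ - G x ξ‖ ^ 2 + 3 * α ^ 2 * ‖g - gradient f x‖ ^ 2
          + 3 * α ^ 2 * ‖G x ξ - gradient f x‖ ^ 2) ∂P := by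
        refine integral_mono hi ((hDi.add (integrable_const _)).add hNi) fun ξ => ?_
        have := norm_add_add_sq_le_three (G y ξ - G x ξ) ((-α) • (g - gradient f x))
          (α • (G x ξ - gradient f x))
        rw [norm_smul, norm_smul, mul_pow, mul_pow, Real.norm_eq_abs, Real.norm_eq_abs, sq_abs,
          sq_abs] at this
        simp only [e]
        linarith
    _ = 3 * ∫ ξ, ‖G y ξ - G x ξ‖ ^ 2 ∂P + 3 * α ^ 2 * ‖g - gradient f x‖ ^ 2
          + 3 * α ^ 2 * ∫ ξ, ‖G x ξ - gradient f x‖ ^ 2 ∂P := by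
        have hadd : Integrable (fun ξ => 3 * ‖G y ξ - G x ξ‖ ^ 2
          + 3 * α ^ 2 * ‖g - gradient f x‖ ^ 2) P := hDi.add (integrable_const _)
        rw [integral_add hadd hNi, integral_add hDi (integrable_const _),
          integral_const_mul, integral_const, integral_const_mul]
        simp only [probReal_univ, one_smul]
    _ ≤ _ := by
        have t1 := h.mean_square_smooth y x
        have t2 := mul_le_mul_of_nonneg_left (h.variance_le x) (show 0 ≤ 3 * α ^ 2 by positivity)
        linarith

end OracleAssumptions

/-! ### Almost decreasing potentials -/

section Sequences

/-- A negative value would persist by monotonicity and drive the partial sums to -∞. -/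
theorem nonneg_of_antitone_of_sum_ge {M : ℕ → ℝ} (hM : Antitone M) {B : ℝ}
    (hB : ∀ n, -B ≤ ∑ k ∈ Finset.range n, M k) (K : ℕ) : 0 ≤ M K := by
  by_contra hneg
  push Not at hneg
  have key : ∀ n : ℕ, ∑ k ∈ Finset.range (K + n), M k
      ≤ ∑ k ∈ Finset.range K, M k + n * M K := by
    intro n
    rw [Finset.sum_range_add]
    have : ∑ x ∈ Finset.range n, M (K + x) ≤ ∑ _x ∈ Finset.range n, M K :=
      Finset.sum_le_sum fun x _ => hM (Nat.le_add_right K x)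
    rw [Finset.sum_const, Finset.card_range, nsmul_eq_mul] at this
    linarith
  obtain ⟨n, hn⟩ := exists_nat_gt ((∑ k ∈ Finset.range K, M k + B) / (-M K))
  rw [div_lt_iff₀ (by linarith)] at hn
  have h1 := key n
  have h2 := hB (K + n)
  linarith

/-- A potential that decreases up to summable errors, and whose partial sums are bounded below by
a telescoping argument, controls the sum of its decrements. -/
theorem sum_decrement_le {Ψ a ε q : ℕ → ℝ} {c S : ℝ} (hc : 0 ≤ c) (ha : ∀ k, 0 ≤ a k)
    (hq : ∀ k, 0 ≤ q k) (hS : ∀ n, ∑ k ∈ Finset.range n, ε k ≤ S)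
    (hstep : ∀ k, Ψ (k + 1) ≤ Ψ k - a k + ε k) (hlow : ∀ k, c * (q (k + 1) - q k) ≤ Ψ k) (n : ℕ) :
    ∑ k ∈ Finset.range n, a k ≤ Ψ 0 + S := by
  -- Adding the part of the error budget S not yet spent makes the potential monotone, and keeps it
  -- above Ψ because partial sums of ε never exceed S.
  set M : ℕ → ℝ := fun k => Ψ k + S - ∑ j ∈ Finset.range k, ε j with hMdef
  have hMstep : ∀ k, M (k + 1) ≤ M k - a k := fun k => by
    simp only [hMdef, Finset.sum_range_succ]
    have := hstep k
    linarith
  have hM : Antitone M := antitone_nat_of_succ_le fun k => by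
    have := hMstep k
    have := ha k
    linarith
  have hM0 : ∀ k, 0 ≤ M k := by
    refine nonneg_of_antitone_of_sum_ge hM (B := c * q 0) fun n => ?_
    calc -(c * q 0) ≤ c * (q n - q 0) := by
          have := mul_nonneg hc (hq n)
          linarith
      _ = ∑ k ∈ Finset.range n, c * (q (k + 1) - q k) := by
          rw [← Finset.mul_sum, Finset.sum_range_sub]
      _ ≤ _ := Finset.sum_le_sum fun k _ => by
          have h1 := hS k
          have h2 := hlow k
          simp only [hMdef]
          linarith
  have hsum : ∑ k ∈ Finset.range n, a k ≤ M 0 - M n := by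
    rw [← Finset.sum_range_sub' M n]
    exact Finset.sum_le_sum fun k _ => by
      have := hMstep k
      linarith
  have h0 : M 0 = Ψ 0 + S := by simp [hMdef]
  have := hM0 n
  linarith

end Sequences

/-! ### The complete recursion in expectation -/

/-- The bounds on one iteration, combined: the potential with the gradient error included. -/
theorem total_potential_step_le {L m h h' V w w' e e' e₁ D π π₁ : ℝ} (hL0 : 0 < L) (hm : 0 < m)
    (hmL : m * L ≤ 1 / 448) (h0 : 0 < h) (hh' : h ≤ h') (hLh' : L * h' ≤ 1 / 1100)
    (hgrow : 1 / h - 1 / h' ≤ 9 / 10 * (121 * L ^ 2) * h) (hw : 0 ≤ w) (hw' : 0 ≤ w')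
    (he : 0 ≤ e) (he' : 0 ≤ e')
    (hπ : π₁ ≤ π - 7 / 10 * h * w + h * e + 1 / 1000 * h' * w' + m / (L * h) * D)
    (hD : D ≤ 3 * L ^ 2 * (h' ^ 2 * w') + 3 * (121 * L ^ 2 * h' ^ 2) ^ 2 * e'
      + 3 * (121 * L ^ 2 * h' ^ 2) ^ 2 * V ^ 2)
    (he₁ : e₁ ≤ (1 - 121 * L ^ 2 * h ^ 2) * e + 2 * L ^ 2 * (h ^ 2 * w)
      + 2 * (121 * L ^ 2 * h ^ 2) ^ 2 * V ^ 2) :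
    π₁ + 1 / (8 * L ^ 2) / h * e₁ + 1 / 20 * (h * (w + e)) ≤
      π + 1 / (8 * L ^ 2) / h' * e + 1 / 20 * (h' * (w' + e')) - 2 / 5 * (h * (w + e))
        + 4000 * L ^ 2 * V ^ 2 * (h' ^ 3 + h ^ 3) := by
  have h'0 : 0 < h' := h0.trans_le hh'
  have hLh : L * h ≤ 1 / 1100 := (mul_le_mul_of_nonneg_left hh' hL0.le).trans hLh'
  have hLh0 : 0 < L * h := mul_pos hL0 h0
  have hratio : h' / h ≤ 11 / 10 := by
    rw [div_le_iff₀ h0]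
    have h1 := sub_le_of_inv_sub_inv_le h0 h'0 hgrow
    have h2 : 109 * L ^ 2 * (h ^ 2 * h') = 109 * ((L * h) * (L * h')) * h := by ring
    have h3 : (L * h) * (L * h') ≤ 1 / 1100 * (1 / 1100) :=
      mul_le_mul hLh hLh' (by positivity) (by norm_num)
    have h4 := mul_le_mul_of_nonneg_right h3 h0.le
    rw [h2] at h1
    linarith
  -- the change of the estimate
  have hD' : m / (L * h) * D ≤ 1 / 100 * (h' * w') + 1 / 100 * (h' * e')
      + 110 * L ^ 2 * V ^ 2 * h' ^ 3 := by
    have hc : 0 ≤ m / (L * h) := by positivity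
    have t1 : m / (L * h) * (3 * L ^ 2 * (h' ^ 2 * w')) ≤ 1 / 100 * (h' * w') := by
      calc _ = 3 * (m * L) * (h' / h) * (h' * w') := by field_simp
        _ ≤ 3 * (1 / 448) * (11 / 10) * (h' * w') := by gcongr
        _ ≤ _ := mul_le_mul_of_nonneg_right (by norm_num) (by positivity)
    have t2 : m / (L * h) * (3 * (121 * L ^ 2 * h' ^ 2) ^ 2 * e') ≤ 1 / 100 * (h' * e') := by
      calc _ = 43923 * (m * L) * (h' / h) * (L * h') ^ 2 * (h' * e') := by field_simp; ring
        _ ≤ 43923 * (1 / 448) * (11 / 10) * (1 / 1100) ^ 2 * (h' * e') := by gcongr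
        _ ≤ _ := mul_le_mul_of_nonneg_right (by norm_num) (by positivity)
    have t3 : m / (L * h) * (3 * (121 * L ^ 2 * h' ^ 2) ^ 2 * V ^ 2)
        ≤ 110 * L ^ 2 * V ^ 2 * h' ^ 3 := by
      calc _ = 43923 * (m * L) * (h' / h) * (L ^ 2 * V ^ 2 * h' ^ 3) := by field_simp; ring
        _ ≤ 43923 * (1 / 448) * (11 / 10) * (L ^ 2 * V ^ 2 * h' ^ 3) := by gcongr
        _ ≤ 110 * (L ^ 2 * V ^ 2 * h' ^ 3) :=
            mul_le_mul_of_nonneg_right (by norm_num) (by positivity)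
        _ = _ := by ring
    have := mul_le_mul_of_nonneg_left hD hc
    linarith
  -- the gradient error
  have herr : 1 / (8 * L ^ 2) / h * e₁ - 1 / (8 * L ^ 2) / h' * e
      ≤ -(121 / 80) * (h * e) + 1 / 4 * (h * w) + 3661 * L ^ 2 * V ^ 2 * h ^ 3 := by
    have hc : 0 ≤ 1 / (8 * L ^ 2) / h := by positivity
    have t := mul_le_mul_of_nonneg_left he₁ hc
    have t' : 1 / (8 * L ^ 2) / h * ((1 - 121 * L ^ 2 * h ^ 2) * e + 2 * L ^ 2 * (h ^ 2 * w)
      + 2 * (121 * L ^ 2 * h ^ 2) ^ 2 * V ^ 2) = 1 / (8 * L ^ 2) * (1 / h * e)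
        - 121 / 8 * (h * e) + 1 / 4 * (h * w) + 14641 / 4 * (L ^ 2 * V ^ 2 * h ^ 3) := by
      field_simp
      ring
    -- Growth of the weight consumes nine tenths of the contraction (121/8)he; the remaining 121/80
    -- exceeds the coefficient 1 with which he enters the potential bound.
    have t'' : 1 / (8 * L ^ 2) * ((1 / h - 1 / h') * e) ≤ 9 / 10 * (121 / 8) * (h * e) := by
      calc _ ≤ 1 / (8 * L ^ 2) * ((9 / 10 * (121 * L ^ 2) * h) * e) := by gcongr
        _ = _ := by field_simp
    have e2 : 1 / (8 * L ^ 2) / h' * e = 1 / (8 * L ^ 2) * (1 / h' * e) := by ring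
    have : 0 ≤ L ^ 2 * V ^ 2 * h ^ 3 := by positivity
    linarith
  have p1 : 0 ≤ L ^ 2 * V ^ 2 * h' ^ 3 := by positivity
  have p2 : 0 ≤ L ^ 2 * V ^ 2 * h ^ 3 := by positivity
  have p3 : 0 ≤ h * e := by positivity
  have p4 : 0 ≤ h * w := by positivity
  have p5 : 0 ≤ h' * e' := by positivity
  have p6 : 0 ≤ h' * w' := by positivity
  -- The budget: hw gets -7/10 + 1/4 + 1/20 = -2/5, he gets 1 - 121/80 + 1/20 < -2/5, and the terms
  -- of the previous index, at most 1/1000 + 1/100, fit in the lagged weight 1/20.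
  linarith

namespace ParamData

variable {p : ParamData}

theorem Admissible.αₖ_nonneg (h : p.Admissible) (k : ℕ) : 0 ≤ p.αₖ k := by
  have := h.c_pos
  unfold αₖ
  positivity

theorem Admissible.αₖ_le_one (h : p.Admissible) (k : ℕ) : p.αₖ k ≤ 1 := by
  have h1 := h.c_pos
  have h3 : p.ηₖ k ≤ p.η := (h.ηₖ_le k).trans (by have := h.η_pos; linarith)
  have h4 := h.ηₖ_pos k
  unfold αₖ
  calc p.c * p.ηₖ k ^ 2 ≤ p.c * p.η ^ 2 := by gcongr
    _ ≤ 1 := h.c_mul_sq_le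

/-- The averaged bound, for the sequences of expectations: `w k` and `e k` are the mean squares of
the scaled step and of the gradient error, `D k` that of the change of the gradient estimate, `π k`
the expected potential and `q k` the mean square of the dual iterate. -/
theorem Admissible.sum_le_of_recursion (hp : p.Admissible) {w e D π q : ℕ → ℝ} {V : ℝ}
    (hw : ∀ k, 0 ≤ w k) (he : ∀ k, 0 ≤ e k) (hq : ∀ k, 0 ≤ q k)
    (hπ : ∀ k, π (k + 1) ≤ π k - 7 / 10 * p.ηₖ (k + 2) * w (k + 1) + p.ηₖ (k + 2) * e (k + 1)
      + 1 / 1000 * p.ηₖ (k + 1) * w k + p.m / (p.Lf * p.ηₖ (k + 2)) * D k)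
    (hD : ∀ k, D k ≤ 3 * p.Lf ^ 2 * (p.ηₖ (k + 1) ^ 2 * w k) + 3 * p.αₖ (k + 1) ^ 2 * e k
      + 3 * p.αₖ (k + 1) ^ 2 * V ^ 2)
    (herr : ∀ k, e (k + 1) ≤ (1 - p.αₖ (k + 1)) * e k + 2 * p.Lf ^ 2 * (p.ηₖ (k + 1) ^ 2 * w k)
      + 2 * p.αₖ (k + 1) ^ 2 * V ^ 2)
    (hlow : ∀ k, 1 / (2 * p.ρ) * (q (k + 1) - q k) ≤ π k) (n : ℕ) :
    ∑ k ∈ Finset.range n, p.ηₖ (k + 2) * (w (k + 1) + e (k + 1)) ≤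
      5 / 2 * (π 0 + 1 / (8 * p.Lf ^ 2) / p.ηₖ 1 * e 1 + 1 / 20 * (p.ηₖ 1 * (w 0 + e 0))
        + 8000 * p.Lf ^ 2 * V ^ 2 * p.η ^ 3) := by
  have hL := hp.Lf_pos
  have hηpos := hp.ηₖ_pos
  have hη := hp.η_pos
  have hρ := hp.ρ_pos
  have key := sum_decrement_le
    (Ψ := fun k => π k + 1 / (8 * p.Lf ^ 2) / p.ηₖ (k + 1) * e (k + 1)
      + 1 / 20 * (p.ηₖ (k + 1) * (w k + e k)))
    (a := fun k => 2 / 5 * (p.ηₖ (k + 2) * (w (k + 1) + e (k + 1))))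
    (ε := fun k => 4000 * p.Lf ^ 2 * V ^ 2 * (p.ηₖ (k + 1) ^ 3 + p.ηₖ (k + 2) ^ 3))
    (q := q) (c := 1 / (2 * p.ρ)) (S := 8000 * p.Lf ^ 2 * V ^ 2 * p.η ^ 3) (by positivity)
    (fun k => by have := hw (k + 1); have := he (k + 1); have := hηpos (k + 2); positivity)
    hq
    (fun n => by
      rw [← Finset.mul_sum, Finset.sum_add_distrib]
      have s1 := hp.sum_ηₖ_cube_le n
      -- The shifted sum is the sum of length n + 1 without its nonnegative first term.
      have s2 : ∑ k ∈ Finset.range n, p.ηₖ (k + 2) ^ 3 ≤ p.η ^ 3 := by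
        have := hp.sum_ηₖ_cube_le (n + 1)
        rw [Finset.sum_range_succ'] at this
        have h1 : 0 ≤ p.ηₖ (0 + 1) ^ 3 := by have := hηpos 1; positivity
        linarith
      have s3 := mul_le_mul_of_nonneg_left (add_le_add s1 s2)
        (show 0 ≤ 4000 * p.Lf ^ 2 * V ^ 2 by positivity)
      linarith)
    (fun k => by
      have h1 := hD k
      have h2 := herr (k + 1)
      have h3 := hp.inv_ηₖ_sub_le (k + 1)
      simp only [αₖ, c] at h1 h2 h3
      refine total_potential_step_le hL hp.m_pos hp.m_mul_Lf_le (hηpos _)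
        (hp.ηₖ_antitone (Nat.le_succ _)) ?_ h3 (hw _) (hw _) (he _) (he _) (hπ k) h1 h2
      have h4 := mul_le_mul_of_nonneg_left (hp.ηₖ_le (k + 1)) hL.le
      have h5 := hp.Lf_mul_η_le
      linarith)
    (fun k => by
      have h1 : 0 ≤ 1 / (8 * p.Lf ^ 2) / p.ηₖ (k + 1) * e (k + 1) := by
        have := hηpos (k + 1); have := he (k + 1); positivity
      have h2 : 0 ≤ 1 / 20 * (p.ηₖ (k + 1) * (w k + e k)) := by
        have := hηpos (k + 1); have := hw k; have := he k; positivity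
      have := hlow k
      linarith) n
  simp only [← Finset.mul_sum, zero_add] at key
  linarith

end ParamData

/-! ### Measurability and independence of the iterates -/

section Iterates

variable {d m : ℕ} {A : EuclideanSpace ℝ (Fin d) →L[ℝ] EuclideanSpace ℝ (Fin m)}
  {b : EuclideanSpace ℝ (Fin m)}

/-- The primal direction: the negative gradient of the augmented Lagrangian, with the gradient of
the objective replaced by its estimate. -/
noncomputable def direction (A : EuclideanSpace ℝ (Fin d) →L[ℝ] EuclideanSpace ℝ (Fin m))
    (b : EuclideanSpace ℝ (Fin m)) (ρ : ℝ) (s : State d m) : EuclideanSpace ℝ (Fin d) :=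
  -(s.g + adjoint A s.lam + ρ • adjoint A (A s.x - b))

theorem primalStep_eq (ρ η : ℝ) (s : State d m) :
    primalStep A b ρ η s = s.x + η • direction A b ρ s := by
  rw [primalStep, direction, smul_neg, sub_eq_add_neg]

/-- The state as a point of a product space. -/
def State.toProd (s : State d m) :
    EuclideanSpace ℝ (Fin d) × EuclideanSpace ℝ (Fin m) × EuclideanSpace ℝ (Fin d) :=
  (s.x, s.lam, s.g)

/-- The state with given components. -/
def State.ofProd
    (z : EuclideanSpace ℝ (Fin d) × EuclideanSpace ℝ (Fin m) × EuclideanSpace ℝ (Fin d)) :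
    State d m :=
  ⟨z.1, z.2.1, z.2.2⟩

theorem continuous_primalStep (ρ η : ℝ) : Continuous fun z :
    EuclideanSpace ℝ (Fin d) × EuclideanSpace ℝ (Fin m) × EuclideanSpace ℝ (Fin d) =>
      primalStep A b ρ η (State.ofProd z) := by
  unfold primalStep State.ofProd
  fun_prop

variable {Ξ : Type*} [MeasurableSpace Ξ]
  {G : EuclideanSpace ℝ (Fin d) → Ξ → EuclideanSpace ℝ (Fin d)}

theorem measurable_step_g (hG : Measurable (Function.uncurry G)) (ρ η α : ℝ) :
    Measurable fun z : (EuclideanSpace ℝ (Fin d) × EuclideanSpace ℝ (Fin m) ×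
      EuclideanSpace ℝ (Fin d)) × Ξ => (step A b G ρ η α z.2 (State.ofProd z.1)).g := by
  have h1 : Measurable fun z : (EuclideanSpace ℝ (Fin d) × EuclideanSpace ℝ (Fin m) ×
      EuclideanSpace ℝ (Fin d)) × Ξ => G (primalStep A b ρ η (State.ofProd z.1)) z.2 :=
    hG.comp (((continuous_primalStep ρ η).measurable.comp measurable_fst).prodMk measurable_snd)
  have h2 : Measurable fun z : (EuclideanSpace ℝ (Fin d) × EuclideanSpace ℝ (Fin m) ×
      EuclideanSpace ℝ (Fin d)) × Ξ => G z.1.1 z.2 :=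
    hG.comp (measurable_fst.fst.prodMk measurable_snd)
  have h3 : Measurable fun z : (EuclideanSpace ℝ (Fin d) × EuclideanSpace ℝ (Fin m) ×
      EuclideanSpace ℝ (Fin d)) × Ξ => z.1.2.2 := measurable_fst.snd.snd
  exact h1.add ((h3.sub h2).const_smul (1 - α))

theorem measurable_step (hG : Measurable (Function.uncurry G)) (ρ η α : ℝ) :
    Measurable fun z : (EuclideanSpace ℝ (Fin d) × EuclideanSpace ℝ (Fin m) ×
      EuclideanSpace ℝ (Fin d)) × Ξ => (step A b G ρ η α z.2 (State.ofProd z.1)).toProd := by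
  have hx : Measurable fun z : (EuclideanSpace ℝ (Fin d) × EuclideanSpace ℝ (Fin m) ×
      EuclideanSpace ℝ (Fin d)) × Ξ => primalStep A b ρ η (State.ofProd z.1) :=
    (continuous_primalStep ρ η).measurable.comp measurable_fst
  have hl : Measurable fun z : (EuclideanSpace ℝ (Fin d) × EuclideanSpace ℝ (Fin m) ×
      EuclideanSpace ℝ (Fin d)) × Ξ =>
        z.1.2.1 + ρ • (A (primalStep A b ρ η (State.ofProd z.1)) - b) :=
    measurable_fst.snd.fst.add (((A.continuous.measurable.comp hx).sub_const b).const_smul ρ)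
  exact hx.prodMk (hl.prodMk (measurable_step_g hG ρ η α))

variable {Ω : Type*} {p : ParamData} {ξ : ℕ → Ω → Ξ} {s₀ : State d m}

/-- The iterates as random states. -/
noncomputable def traj (p : ParamData)
    (A : EuclideanSpace ℝ (Fin d) →L[ℝ] EuclideanSpace ℝ (Fin m)) (b : EuclideanSpace ℝ (Fin m))
    (G : EuclideanSpace ℝ (Fin d) → Ξ → EuclideanSpace ℝ (Fin d)) (s₀ : State d m)
    (ξ : ℕ → Ω → Ξ) (k : ℕ) (ω : Ω) : State d m :=
  iterate p A b G s₀ (fun j => ξ j ω) k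

/-- State k depends only on samples 1, …, k. Stating this with a supremum over an index set lets
independence from sample k + 1 follow from disjointness of index sets. -/
theorem measurable_traj_iSup (hG : Measurable (Function.uncurry G)) (k : ℕ) :
    Measurable[⨆ j ∈ Set.Iio k, MeasurableSpace.comap (ξ (j + 1)) inferInstance]
      fun ω => (traj p A b G s₀ ξ k ω).toProd := by
  induction k with
  | zero => exact @measurable_const _ _ (_) (_) s₀.toProd
  | succ k ih =>
    have h1 : Measurable[⨆ j ∈ Set.Iio (k + 1), MeasurableSpace.comap (ξ (j + 1)) inferInstance]
        fun ω => (traj p A b G s₀ ξ k ω).toProd :=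
      ih.mono (biSup_mono fun j (hj : j < k) => Nat.lt_succ_of_lt hj) le_rfl
    have h2 : Measurable[⨆ j ∈ Set.Iio (k + 1), MeasurableSpace.comap (ξ (j + 1)) inferInstance]
        (ξ (k + 1)) :=
      (comap_measurable (ξ (k + 1))).mono
        (le_biSup (fun j => MeasurableSpace.comap (ξ (j + 1)) inferInstance)
          (show k ∈ Set.Iio (k + 1) from Nat.lt_succ_self k)) le_rfl
    exact (measurable_step (A := A) (b := b) hG p.ρ (p.ηₖ (k + 1)) (p.αₖ (k + 1))).comp
      (h1.prodMk h2)

variable [MeasurableSpace Ω] {P : Measure Ξ} {μ : Measure Ω}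

theorem measurable_traj (hG : Measurable (Function.uncurry G))
    (hξ : ∀ k, Measurable (ξ (k + 1))) (k : ℕ) :
    Measurable fun ω => (traj p A b G s₀ ξ k ω).toProd :=
  (measurable_traj_iSup hG k).mono (iSup₂_le fun j _ => (hξ j).comap_le) le_rfl

theorem indepFun_traj (hG : Measurable (Function.uncurry G)) (hξ : ∀ k, Measurable (ξ (k + 1)))
    (hind : iIndepFun (fun k : ℕ => ξ (k + 1)) μ) (k : ℕ) :
    IndepFun (fun ω => (traj p A b G s₀ ξ k ω).toProd) (ξ (k + 1)) μ := by
  have h1 := indep_iSup_of_disjoint (fun j => (hξ j).comap_le) hind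
    (S := Set.Iio k) (T := {k}) (by simp)
  rw [iSup_singleton] at h1
  exact indep_of_indep_of_le_left h1 (measurable_iff_comap_le.1 (measurable_traj_iSup hG k))

end Iterates

/-! ### Square integrability and one iteration in expectation -/

theorem integrable_inner_of_memLp_two {Ω E : Type*} [MeasurableSpace Ω] {μ : Measure Ω}
    [NormedAddCommGroup E] [InnerProductSpace ℝ E] {u v : Ω → E} (hu : MemLp u 2 μ)
    (hv : MemLp v 2 μ) : Integrable (fun ω => inner ℝ (u ω) (v ω)) μ := by
  have hu2 : Integrable (fun ω => ‖u ω‖ ^ 2) μ := hu.integrable_norm_pow (by norm_num)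
  have hv2 : Integrable (fun ω => ‖v ω‖ ^ 2) μ := hv.integrable_norm_pow (by norm_num)
  refine (hu2.add hv2).mono' (hu.1.inner hv.1) (Filter.Eventually.of_forall fun ω => ?_)
  have := norm_inner_le_norm (𝕜 := ℝ) (u ω) (v ω)
  simp only [Pi.add_apply]
  nlinarith [sq_nonneg (‖u ω‖ - ‖v ω‖), sq_nonneg ‖u ω‖, sq_nonneg ‖v ω‖]

/-- What is assumed of a run of the method: consistent parameters, the oracle assumptions, and
independent samples. -/
structure RunAssumptions {d m : ℕ} {Ξ Ω : Type*} [MeasurableSpace Ξ] [MeasurableSpace Ω]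
    (p : ParamData) (A : EuclideanSpace ℝ (Fin d) →L[ℝ] EuclideanSpace ℝ (Fin m))
    (P : Measure Ξ) (μ : Measure Ω) (f : EuclideanSpace ℝ (Fin d) → ℝ)
    (G : EuclideanSpace ℝ (Fin d) → Ξ → EuclideanSpace ℝ (Fin d)) (V : ℝ) (ξ : ℕ → Ω → Ξ) :
    Prop where
  admissible : p.Admissible
  normA_eq : p.normA = ‖A‖
  eigenvalue : IsSmallestNonzeroEigenvalue A p.δ
  oracle : OracleAssumptions P f G p.Lf V
  sample : ∀ k : ℕ, MeasurePreserving (ξ (k + 1)) μ P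
  indep : iIndepFun (fun k : ℕ => ξ (k + 1)) μ

namespace RunAssumptions

variable {d m : ℕ} {Ξ Ω : Type*} [MeasurableSpace Ξ] [MeasurableSpace Ω] {p : ParamData}
  {A : EuclideanSpace ℝ (Fin d) →L[ℝ] EuclideanSpace ℝ (Fin m)} {P : Measure Ξ} {μ : Measure Ω}
  {f : EuclideanSpace ℝ (Fin d) → ℝ}
  {G : EuclideanSpace ℝ (Fin d) → Ξ → EuclideanSpace ℝ (Fin d)} {V : ℝ} {ξ : ℕ → Ω → Ξ}

theorem measurable_prod (h : RunAssumptions p A P μ f G V ξ) (b : EuclideanSpace ℝ (Fin m))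
    (s₀ : State d m) (k : ℕ) : Measurable fun ω => (traj p A b G s₀ ξ k ω).toProd :=
  measurable_traj h.oracle.measurable (fun k => (h.sample k).measurable) k

variable [IsProbabilityMeasure P] [IsProbabilityMeasure μ]

theorem memLp_gradient (h : RunAssumptions p A P μ f G V ξ) {x : Ω → EuclideanSpace ℝ (Fin d)}
    (hx : MemLp x 2 μ) : MemLp (fun ω => gradient f (x ω)) 2 μ := by
  have hL := h.admissible.Lf_pos
  have hc : MemLp (fun _ : Ω => ‖gradient f 0‖) 2 μ := memLp_const _
  have hn : MemLp (fun ω => p.Lf * ‖x ω‖) 2 μ := hx.norm.const_mul p.Lf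
  have hb : MemLp (fun ω => ‖gradient f 0‖ + p.Lf * ‖x ω‖) 2 μ := hc.add hn
  refine hb.of_le ((h.oracle.continuous_gradient hL).comp_aestronglyMeasurable hx.1)
    (Filter.Eventually.of_forall fun ω => ?_)
  have h1 := h.oracle.gradient_lipschitz hL (x ω) 0
  rw [sub_zero] at h1
  have h2 := norm_le_insert' (gradient f (x ω)) (gradient f 0)
  exact (h2.trans (by linarith)).trans (le_abs_self _)

/-- f lies between 0 and its quadratic majorant at the origin. -/
theorem integrable_objective (h : RunAssumptions p A P μ f G V ξ)
    {x : Ω → EuclideanSpace ℝ (Fin d)} (hx : MemLp x 2 μ) : Integrable (fun ω => f (x ω)) μ := by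
  have hL := h.admissible.Lf_pos
  have hx1 : Integrable x μ := hx.integrable (by norm_num)
  have hx2 : Integrable (fun ω => ‖x ω‖ ^ 2) μ := hx.integrable_norm_pow (by norm_num)
  have hb : Integrable (fun ω => f 0 + inner ℝ (gradient f 0) (x ω) + p.Lf / 2 * ‖x ω‖ ^ 2) μ :=
    ((integrable_const _).add (hx1.const_inner _)).add (hx2.const_mul _)
  refine hb.mono' (h.oracle.differentiable.continuous.comp_aestronglyMeasurable hx.1)
    (Filter.Eventually.of_forall fun ω => ?_)
  have h1 := le_add_inner_gradient_add h.oracle.differentiable (h.oracle.gradient_lipschitz hL)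
    0 (x ω)
  rw [zero_add] at h1
  rwa [Real.norm_of_nonneg (h.oracle.nonneg _)]

theorem memLp_x_next (A : EuclideanSpace ℝ (Fin d) →L[ℝ] EuclideanSpace ℝ (Fin m))
    (b : EuclideanSpace ℝ (Fin m)) (ρ η : ℝ) {s : Ω → State d m}
    (hx : MemLp (fun ω => (s ω).x) 2 μ) (hl : MemLp (fun ω => (s ω).lam) 2 μ)
    (hg : MemLp (fun ω => (s ω).g) 2 μ) : MemLp (fun ω => primalStep A b ρ η (s ω)) 2 μ := by
  have h1 : MemLp (fun ω => adjoint A ((s ω).lam)) 2 μ := (adjoint A).comp_memLp' hl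
  have h2 : MemLp (fun ω => A ((s ω).x) - b) 2 μ := (A.comp_memLp' hx).sub (memLp_const b)
  have h3 : MemLp (fun ω => adjoint A (A ((s ω).x) - b)) 2 μ := (adjoint A).comp_memLp' h2
  exact hx.sub (((hg.add h1).add (h3.const_smul ρ)).const_smul η)

/-- One iteration, in expectation, given that the current state is square integrable. -/
theorem expectation_step (h : RunAssumptions p A P μ f G V ξ) (b : EuclideanSpace ℝ (Fin m))
    (s₀ : State d m) (k : ℕ)
    (hx : MemLp (fun ω => (traj p A b G s₀ ξ k ω).x) 2 μ)
    (hl : MemLp (fun ω => (traj p A b G s₀ ξ k ω).lam) 2 μ)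
    (hg : MemLp (fun ω => (traj p A b G s₀ ξ k ω).g) 2 μ) :
    (Integrable (fun ω => ‖(traj p A b G s₀ ξ (k + 1) ω).g - (traj p A b G s₀ ξ k ω).g‖ ^ 2) μ ∧
      ∫ ω, ‖(traj p A b G s₀ ξ (k + 1) ω).g - (traj p A b G s₀ ξ k ω).g‖ ^ 2 ∂μ ≤
        ∫ ω, (3 * p.Lf ^ 2 * ‖(traj p A b G s₀ ξ (k + 1) ω).x - (traj p A b G s₀ ξ k ω).x‖ ^ 2
          + 3 * p.αₖ (k + 1) ^ 2 *
            ‖(traj p A b G s₀ ξ k ω).g - gradient f (traj p A b G s₀ ξ k ω).x‖ ^ 2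
          + 3 * p.αₖ (k + 1) ^ 2 * V ^ 2) ∂μ) ∧
    ∫ ω, ‖(traj p A b G s₀ ξ (k + 1) ω).g - gradient f (traj p A b G s₀ ξ (k + 1) ω).x‖ ^ 2 ∂μ ≤
        ∫ ω, ((1 - p.αₖ (k + 1)) *
            ‖(traj p A b G s₀ ξ k ω).g - gradient f (traj p A b G s₀ ξ k ω).x‖ ^ 2
          + 2 * p.Lf ^ 2 * ‖(traj p A b G s₀ ξ (k + 1) ω).x - (traj p A b G s₀ ξ k ω).x‖ ^ 2
          + 2 * p.αₖ (k + 1) ^ 2 * V ^ 2) ∂μ := by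
  have hT := h.measurable_prod b s₀ k
  -- The point x_{k+1} is already a function of state k, so sample k + 1 is fresh for both oracle
  -- evaluations.
  have hTX := indepFun_traj (p := p) (A := A) (b := b) (s₀ := s₀) h.oracle.measurable
    (fun k => (h.sample k).measurable) h.indep k
  have hgradm := (h.oracle.continuous_gradient h.admissible.Lf_pos).measurable
  have hstep := measurable_step_g (A := A) (b := b) h.oracle.measurable p.ρ (p.ηₖ (k + 1))
    (p.αₖ (k + 1))
  have hprim := (continuous_primalStep (A := A) (b := b) p.ρ (p.ηₖ (k + 1))).measurable
  have hgm : Measurable fun z : EuclideanSpace ℝ (Fin d) × EuclideanSpace ℝ (Fin m) ×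
      EuclideanSpace ℝ (Fin d) => z.2.2 := measurable_snd.snd
  have hx2 : Integrable (fun ω => ‖(traj p A b G s₀ ξ (k + 1) ω).x
      - (traj p A b G s₀ ξ k ω).x‖ ^ 2) μ :=
    ((memLp_x_next A b p.ρ (p.ηₖ (k + 1)) hx hl hg).sub hx).integrable_norm_pow (by norm_num)
  have he2 : Integrable (fun ω => ‖(traj p A b G s₀ ξ k ω).g
      - gradient f (traj p A b G s₀ ξ k ω).x‖ ^ 2) μ :=
    (hg.sub (h.memLp_gradient hx)).integrable_norm_pow (by norm_num)
  have hdm : Measurable fun z : EuclideanSpace ℝ (Fin d) × EuclideanSpace ℝ (Fin m) ×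
      EuclideanSpace ℝ (Fin d) =>
        ‖primalStep A b p.ρ (p.ηₖ (k + 1)) (State.ofProd z) - z.1‖ ^ 2 :=
    (hprim.sub measurable_fst).norm.pow_const 2
  have hem : Measurable fun z : EuclideanSpace ℝ (Fin d) × EuclideanSpace ℝ (Fin m) ×
      EuclideanSpace ℝ (Fin d) => ‖z.2.2 - gradient f z.1‖ ^ 2 :=
    (hgm.sub (hgradm.comp measurable_fst)).norm.pow_const 2
  constructor
  · have hchange := fun z : EuclideanSpace ℝ (Fin d) × EuclideanSpace ℝ (Fin m) ×
        EuclideanSpace ℝ (Fin d) => h.oracle.estimator_change (p.αₖ (k + 1)) z.1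
      (primalStep A b p.ρ (p.ηₖ (k + 1)) (State.ofProd z)) z.2.2
    have hint : Integrable (fun ω =>
        3 * p.Lf ^ 2 * ‖(traj p A b G s₀ ξ (k + 1) ω).x - (traj p A b G s₀ ξ k ω).x‖ ^ 2
          + 3 * p.αₖ (k + 1) ^ 2 *
            ‖(traj p A b G s₀ ξ k ω).g - gradient f (traj p A b G s₀ ξ k ω).x‖ ^ 2
          + 3 * p.αₖ (k + 1) ^ 2 * V ^ 2) μ :=
      ((hx2.const_mul _).add (he2.const_mul _)).add (integrable_const _)
    exact integrable_and_integral_le_of_indepFun hT (h.sample k) hTX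
      (φ := fun z => ‖(step A b G p.ρ (p.ηₖ (k + 1)) (p.αₖ (k + 1)) z.2 (State.ofProd z.1)).g
        - z.1.2.2‖ ^ 2)
      ((hstep.sub (hgm.comp measurable_fst)).norm.pow_const 2) (fun z => by positivity)
      (B := fun z => 3 * p.Lf ^ 2 *
          ‖primalStep A b p.ρ (p.ηₖ (k + 1)) (State.ofProd z) - z.1‖ ^ 2
        + 3 * p.αₖ (k + 1) ^ 2 * ‖z.2.2 - gradient f z.1‖ ^ 2 + 3 * p.αₖ (k + 1) ^ 2 * V ^ 2)
      (((hdm.const_mul _).add (hem.const_mul _)).add_const _)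
      (fun z => (hchange z).1) (fun z => (hchange z).2) hint
  · have herror := fun z : EuclideanSpace ℝ (Fin d) × EuclideanSpace ℝ (Fin m) ×
        EuclideanSpace ℝ (Fin d) => h.oracle.estimator_error (h.admissible.αₖ_nonneg (k + 1))
      (h.admissible.αₖ_le_one (k + 1)) z.1
      (primalStep A b p.ρ (p.ηₖ (k + 1)) (State.ofProd z)) z.2.2
    have hint : Integrable (fun ω => (1 - p.αₖ (k + 1)) *
            ‖(traj p A b G s₀ ξ k ω).g - gradient f (traj p A b G s₀ ξ k ω).x‖ ^ 2
          + 2 * p.Lf ^ 2 * ‖(traj p A b G s₀ ξ (k + 1) ω).x - (traj p A b G s₀ ξ k ω).x‖ ^ 2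
          + 2 * p.αₖ (k + 1) ^ 2 * V ^ 2) μ :=
      ((he2.const_mul _).add (hx2.const_mul _)).add (integrable_const _)
    exact (integrable_and_integral_le_of_indepFun hT (h.sample k) hTX
      (φ := fun z => ‖(step A b G p.ρ (p.ηₖ (k + 1)) (p.αₖ (k + 1)) z.2 (State.ofProd z.1)).g
        - gradient f (primalStep A b p.ρ (p.ηₖ (k + 1)) (State.ofProd z.1))‖ ^ 2)
      ((hstep.sub (hgradm.comp (hprim.comp measurable_fst))).norm.pow_const 2)
      (fun z => by positivity)
      (B := fun z => (1 - p.αₖ (k + 1)) * ‖z.2.2 - gradient f z.1‖ ^ 2 + 2 * p.Lf ^ 2 *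
          ‖primalStep A b p.ρ (p.ηₖ (k + 1)) (State.ofProd z) - z.1‖ ^ 2
        + 2 * p.αₖ (k + 1) ^ 2 * V ^ 2)
      (((hem.const_mul _).add (hdm.const_mul _)).add_const _)
      (fun z => (herror z).1) (fun z => (herror z).2) hint).2

/-- The new x and λ are affine in the old state; the new g is the old one plus an increment that
`expectation_step` shows to be square integrable. -/
theorem memLp_traj (h : RunAssumptions p A P μ f G V ξ) (b : EuclideanSpace ℝ (Fin m))
    (s₀ : State d m) (k : ℕ) :
    MemLp (fun ω => (traj p A b G s₀ ξ k ω).x) 2 μ ∧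
    MemLp (fun ω => (traj p A b G s₀ ξ k ω).lam) 2 μ ∧
    MemLp (fun ω => (traj p A b G s₀ ξ k ω).g) 2 μ := by
  induction k with
  | zero => exact ⟨memLp_const s₀.x, memLp_const s₀.lam, memLp_const s₀.g⟩
  | succ k ih =>
    obtain ⟨hx, hl, hg⟩ := ih
    have hx' : MemLp (fun ω => (traj p A b G s₀ ξ (k + 1) ω).x) 2 μ :=
      memLp_x_next A b p.ρ (p.ηₖ (k + 1)) hx hl hg
    have hr : MemLp (fun ω => A (traj p A b G s₀ ξ (k + 1) ω).x - b) 2 μ :=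
      (A.comp_memLp' hx').sub (memLp_const b)
    refine ⟨hx', hl.add (hr.const_smul p.ρ), ?_⟩
    have hi := (h.expectation_step b s₀ k hx hl hg).1.1
    have hm' : Measurable fun ω => (traj p A b G s₀ ξ (k + 1) ω).g :=
      (h.measurable_prod b s₀ (k + 1)).snd.snd
    have hm : Measurable fun ω => (traj p A b G s₀ ξ k ω).g := (h.measurable_prod b s₀ k).snd.snd
    have hd : MemLp (fun ω => (traj p A b G s₀ ξ (k + 1) ω).g - (traj p A b G s₀ ξ k ω).g) 2 μ :=
      (memLp_two_iff_integrable_sq_norm (hm'.sub hm).aestronglyMeasurable).2 hi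
    have := hd.add hg
    simpa only [Pi.add_def, sub_add_cancel] using this

end RunAssumptions

/-! ### Reduction to the range of A -/

section RangeProjection

variable {d m : ℕ}

/-- The orthogonal projection onto the range of `A`. -/
noncomputable def rangeProj (A : EuclideanSpace ℝ (Fin d) →L[ℝ] EuclideanSpace ℝ (Fin m)) :
    EuclideanSpace ℝ (Fin m) →L[ℝ] EuclideanSpace ℝ (Fin m) :=
  (LinearMap.range (A : EuclideanSpace ℝ (Fin d) →ₗ[ℝ] EuclideanSpace ℝ (Fin m))).starProjection

variable (A : EuclideanSpace ℝ (Fin d) →L[ℝ] EuclideanSpace ℝ (Fin m))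

theorem rangeProj_apply_self (x : EuclideanSpace ℝ (Fin d)) : rangeProj A (A x) = A x :=
  Submodule.starProjection_eq_self_iff.2 ⟨x, rfl⟩

theorem adjoint_rangeProj (l : EuclideanSpace ℝ (Fin m)) :
    adjoint A (rangeProj A l) = adjoint A l := by
  refine ext_inner_right ℝ fun z => ?_
  rw [ContinuousLinearMap.adjoint_inner_left, ContinuousLinearMap.adjoint_inner_left, eq_comm,
    ← sub_eq_zero, ← inner_sub_left]
  exact Submodule.starProjection_inner_eq_zero l _ ⟨z, rfl⟩

theorem IsSmallestNonzeroEigenvalue.mul_norm_sub_rangeProj_sq_le {δ : ℝ}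
    {A : EuclideanSpace ℝ (Fin d) →L[ℝ] EuclideanSpace ℝ (Fin m)}
    (h : IsSmallestNonzeroEigenvalue A δ) (x : EuclideanSpace ℝ (Fin d))
    (b : EuclideanSpace ℝ (Fin m)) :
    δ * ‖A x - rangeProj A b‖ ^ 2 ≤ ‖adjoint A (A x - rangeProj A b)‖ ^ 2 := by
  obtain ⟨z, hz⟩ : rangeProj A b ∈
      LinearMap.range (A : EuclideanSpace ℝ (Fin d) →ₗ[ℝ] EuclideanSpace ℝ (Fin m)) :=
    Submodule.starProjection_apply_mem _ b
  have hz' : rangeProj A b = A z := hz.symm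
  rw [hz', ← map_sub]
  exact h.mul_norm_sq_le _

/-- The spectral gap applies only to vectors in the range of A, while Ax - b may leave it. The
primal dynamics see λ and b only through Aᵀ, so both can be projected. -/
theorem direction_eq_rangeProj (b : EuclideanSpace ℝ (Fin m)) (ρ : ℝ) (s : State d m) :
    direction A b ρ s
      = -(s.g + adjoint A (rangeProj A s.lam) + ρ • adjoint A (A s.x - rangeProj A b)) := by
  rw [direction, adjoint_rangeProj, map_sub, map_sub, adjoint_rangeProj]

end RangeProjection

/-! ### The potential along the trajectory -/

section Trajectory

variable {d m : ℕ} {Ξ Ω : Type*} {p : ParamData}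
  {A : EuclideanSpace ℝ (Fin d) →L[ℝ] EuclideanSpace ℝ (Fin m)}
  {f : EuclideanSpace ℝ (Fin d) → ℝ}
  {G : EuclideanSpace ℝ (Fin d) → Ξ → EuclideanSpace ℝ (Fin d)} {ξ : ℕ → Ω → Ξ}
  {b : EuclideanSpace ℝ (Fin m)} {s₀ : State d m}

theorem traj_succ_x (k : ℕ) (ω : Ω) : (traj p A b G s₀ ξ (k + 1) ω).x
    = (traj p A b G s₀ ξ k ω).x + p.ηₖ (k + 1) • direction A b p.ρ (traj p A b G s₀ ξ k ω) :=
  primalStep_eq p.ρ (p.ηₖ (k + 1)) (traj p A b G s₀ ξ k ω)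

theorem rangeProj_traj_succ_lam (k : ℕ) (ω : Ω) : rangeProj A (traj p A b G s₀ ξ (k + 1) ω).lam
    = rangeProj A (traj p A b G s₀ ξ k ω).lam
      + p.ρ • (A (traj p A b G s₀ ξ (k + 1) ω).x - rangeProj A b) := by
  have h : (traj p A b G s₀ ξ (k + 1) ω).lam = (traj p A b G s₀ ξ k ω).lam
      + p.ρ • (A (traj p A b G s₀ ξ (k + 1) ω).x - b) := rfl
  rw [h, map_add, map_smul, map_sub, rangeProj_apply_self]

theorem residual_succ (hp : p.Admissible) (k : ℕ) (ω : Ω) :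
    residual p A b f G s₀ (fun j => ξ j ω) (k + 1)
      = ‖direction A b p.ρ (traj p A b G s₀ ξ k ω)‖ ^ 2
        + ‖(traj p A b G s₀ ξ k ω).g - gradient f (traj p A b G s₀ ξ k ω).x‖ ^ 2 := by
  have h1 : (iterate p A b G s₀ (fun j => ξ j ω) (k + 1)).x = _ :=
    traj_succ_x (p := p) (A := A) (b := b) (G := G) (s₀ := s₀) (ξ := ξ) k ω
  have h2 := (hp.ηₖ_pos (k + 1)).ne'
  unfold residual
  rw [h1, Nat.add_sub_cancel]
  change ‖(p.ηₖ (k + 1))⁻¹ • ((traj p A b G s₀ ξ k ω).x + _ - (traj p A b G s₀ ξ k ω).x)‖ ^ 2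
    + _ = _
  rw [add_sub_cancel_left, smul_smul, inv_mul_cancel₀ h2, one_smul]
  rfl

/-- The potential along the iterates, from index `1` on. -/
noncomputable def pathPotential (p : ParamData)
    (A : EuclideanSpace ℝ (Fin d) →L[ℝ] EuclideanSpace ℝ (Fin m)) (b : EuclideanSpace ℝ (Fin m))
    (f : EuclideanSpace ℝ (Fin d) → ℝ)
    (G : EuclideanSpace ℝ (Fin d) → Ξ → EuclideanSpace ℝ (Fin d)) (s₀ : State d m)
    (ξ : ℕ → Ω → Ξ) (k : ℕ) (ω : Ω) : ℝ :=
  -- State k + 1 is paired with the direction that led to it, and the weight uses the size of the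
  -- step about to be taken.
  potential f A (rangeProj A b) p.ρ p.m (p.ηₖ (k + 2)) (traj p A b G s₀ ξ (k + 1) ω).x
    (rangeProj A (traj p A b G s₀ ξ (k + 1) ω).lam) (direction A b p.ρ (traj p A b G s₀ ξ k ω))

end Trajectory

namespace RunAssumptions

variable {d m : ℕ} {Ξ Ω : Type*} [MeasurableSpace Ξ] [MeasurableSpace Ω] {p : ParamData}
  {A : EuclideanSpace ℝ (Fin d) →L[ℝ] EuclideanSpace ℝ (Fin m)} {P : Measure Ξ} {μ : Measure Ω}
  {f : EuclideanSpace ℝ (Fin d) → ℝ}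
  {G : EuclideanSpace ℝ (Fin d) → Ξ → EuclideanSpace ℝ (Fin d)} {V : ℝ} {ξ : ℕ → Ω → Ξ}

/-- Expanding ‖λ_k‖² = ‖λ_{k+1} - ρr‖² gives ⟨λ_{k+1}, r⟩ as a difference of squares plus (ρ/2)‖r‖²;
every other term is nonnegative. The telescoping form replaces a bound on the multipliers. -/
theorem le_pathPotential (h : RunAssumptions p A P μ f G V ξ) (b : EuclideanSpace ℝ (Fin m))
    (s₀ : State d m) (k : ℕ) (ω : Ω) :
    1 / (2 * p.ρ) * (‖rangeProj A (traj p A b G s₀ ξ (k + 1) ω).lam‖ ^ 2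
      - ‖rangeProj A (traj p A b G s₀ ξ k ω).lam‖ ^ 2) ≤ pathPotential p A b f G s₀ ξ k ω := by
  have hρ := h.admissible.ρ_pos
  have hm := h.admissible.m_pos
  have hη := h.admissible.ηₖ_pos (k + 2)
  have hl := rangeProj_traj_succ_lam (p := p) (A := A) (b := b) (G := G) (s₀ := s₀) (ξ := ξ) k ω
  have hf := h.oracle.nonneg (traj p A b G s₀ ξ (k + 1) ω).x
  unfold pathPotential potential augLagrangian
  set r := A (traj p A b G s₀ ξ (k + 1) ω).x - rangeProj A b
  set l₁ := rangeProj A (traj p A b G s₀ ξ (k + 1) ω).lam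
  set l := rangeProj A (traj p A b G s₀ ξ k ω).lam
  have e : l = l₁ - p.ρ • r := by rw [hl, add_sub_cancel_right]
  have h1 : 1 / (2 * p.ρ) * (‖l₁‖ ^ 2 - ‖l‖ ^ 2) = inner ℝ l₁ r - p.ρ / 2 * ‖r‖ ^ 2 := by
    rw [e, norm_sub_sq_real, real_inner_smul_right, norm_smul, mul_pow, Real.norm_eq_abs, sq_abs]
    field_simp
    ring
  have h2 : 0 ≤ p.ρ / 2 * ‖r‖ ^ 2 := by positivity
  have h3 : 0 ≤ p.m / p.ηₖ (k + 2) * (p.ρ / 2) * ‖r‖ ^ 2 := by positivity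
  have h4 : 0 ≤ p.m / 2 * ‖direction A b p.ρ (traj p A b G s₀ ξ k ω)‖ ^ 2 := by positivity
  rw [h1]
  linarith

variable [IsProbabilityMeasure P]

theorem pathPotential_succ_le (h : RunAssumptions p A P μ f G V ξ) (b : EuclideanSpace ℝ (Fin m))
    (s₀ : State d m) (k : ℕ) (ω : Ω) :
    pathPotential p A b f G s₀ ξ (k + 1) ω ≤ pathPotential p A b f G s₀ ξ k ω
      - 7 / 10 * p.ηₖ (k + 2) * ‖direction A b p.ρ (traj p A b G s₀ ξ (k + 1) ω)‖ ^ 2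
      + p.ηₖ (k + 2) * ‖(traj p A b G s₀ ξ (k + 1) ω).g
          - gradient f (traj p A b G s₀ ξ (k + 1) ω).x‖ ^ 2
      + 1 / 1000 * p.ηₖ (k + 1) * ‖direction A b p.ρ (traj p A b G s₀ ξ k ω)‖ ^ 2
      + p.m / (p.Lf * p.ηₖ (k + 2)) *
        ‖(traj p A b G s₀ ξ (k + 1) ω).g - (traj p A b G s₀ ξ k ω).g‖ ^ 2 := by
  have hp := h.admissible
  have hL := hp.Lf_pos
  have hx₁ := traj_succ_x (p := p) (A := A) (b := b) (G := G) (s₀ := s₀) (ξ := ξ) k ω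
  have hx₂ := traj_succ_x (p := p) (A := A) (b := b) (G := G) (s₀ := s₀) (ξ := ξ) (k + 1) ω
  have hl₁ := rangeProj_traj_succ_lam (p := p) (A := A) (b := b) (G := G) (s₀ := s₀) (ξ := ξ) k ω
  have hl₂ := rangeProj_traj_succ_lam (p := p) (A := A) (b := b) (G := G) (s₀ := s₀) (ξ := ξ)
    (k + 1) ω
  have hv' := direction_eq_rangeProj A b p.ρ (traj p A b G s₀ ξ k ω)
  have hv := direction_eq_rangeProj A b p.ρ (traj p A b G s₀ ξ (k + 1) ω)
  have hgap := h.eigenvalue.mul_norm_sub_rangeProj_sq_le (traj p A b G s₀ ξ (k + 1 + 1) ω).x b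
  unfold pathPotential
  rw [hl₂]
  rw [hx₂] at hgap ⊢
  rw [hl₁] at hv ⊢
  rw [hx₁] at hv hgap ⊢
  have hg := hp.inv_ηₖ_sub_le (k + 1)
  have hg' := hp.inv_ηₖ_sub_le (k + 2)
  have hηA := hp.η_mul
  rw [h.normA_eq] at hηA
  refine potential_step_le h.oracle.differentiable (h.oracle.gradient_lipschitz hL) A _ hL
    hp.ρ_pos hp.η_pos hp.m_pos hp.m_mul_Lf_le hp.seven_le hηA (hp.ηₖ_pos (k + 2))
    (hp.ηₖ_antitone (Nat.le_succ (k + 1))) (hp.ηₖ_le (k + 1)) hg ?_ hv' hv hgap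
  have h1 := mul_le_mul_of_nonneg_left hg' hp.m_pos.le
  have h2 : p.m * (9 / 10 * p.c * p.ηₖ (k + 2 + 1))
      = 1089 / 10 * (p.m * p.Lf) * (p.Lf * p.ηₖ (k + 2 + 1)) := by
    rw [ParamData.c]; ring
  have h3 : p.Lf * p.ηₖ (k + 2 + 1) ≤ 1 / 1100 := by
    have h4 := mul_le_mul_of_nonneg_left (hp.ηₖ_le (k + 2 + 1)) hL.le
    have h5 := hp.Lf_mul_η_le
    linarith
  have h6 : (p.m * p.Lf) * (p.Lf * p.ηₖ (k + 2 + 1)) ≤ 1 / 448 * (1 / 1100) :=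
    mul_le_mul hp.m_mul_Lf_le h3 (mul_nonneg hL.le (hp.ηₖ_pos _).le) (by norm_num)
  exact h1.trans (by rw [h2]; linarith)

variable [IsProbabilityMeasure μ]

theorem memLp_direction (h : RunAssumptions p A P μ f G V ξ) (b : EuclideanSpace ℝ (Fin m))
    (s₀ : State d m) (k : ℕ) :
    MemLp (fun ω => direction A b p.ρ (traj p A b G s₀ ξ k ω)) 2 μ := by
  obtain ⟨hx, hl, hg⟩ := h.memLp_traj b s₀ k
  have h1 : MemLp (fun ω => adjoint A (traj p A b G s₀ ξ k ω).lam) 2 μ := (adjoint A).comp_memLp' hl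
  have h2 : MemLp (fun ω => A (traj p A b G s₀ ξ k ω).x - b) 2 μ :=
    (A.comp_memLp' hx).sub (memLp_const b)
  have h3 : MemLp (fun ω => adjoint A (A (traj p A b G s₀ ξ k ω).x - b)) 2 μ :=
    (adjoint A).comp_memLp' h2
  exact ((hg.add h1).add (h3.const_smul p.ρ)).neg

theorem memLp_error (h : RunAssumptions p A P μ f G V ξ) (b : EuclideanSpace ℝ (Fin m))
    (s₀ : State d m) (k : ℕ) : MemLp (fun ω => (traj p A b G s₀ ξ k ω).g
      - gradient f (traj p A b G s₀ ξ k ω).x) 2 μ :=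
  (h.memLp_traj b s₀ k).2.2.sub (h.memLp_gradient (h.memLp_traj b s₀ k).1)

theorem integrable_pathPotential (h : RunAssumptions p A P μ f G V ξ)
    (b : EuclideanSpace ℝ (Fin m)) (s₀ : State d m) (k : ℕ) :
    Integrable (pathPotential p A b f G s₀ ξ k) μ := by
  obtain ⟨hx, hl, -⟩ := h.memLp_traj b s₀ (k + 1)
  have hr : MemLp (fun ω => A (traj p A b G s₀ ξ (k + 1) ω).x - rangeProj A b) 2 μ :=
    (A.comp_memLp' hx).sub (memLp_const _)
  have hl' : MemLp (fun ω => rangeProj A (traj p A b G s₀ ξ (k + 1) ω).lam) 2 μ :=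
    (rangeProj A).comp_memLp' hl
  have hr2 : Integrable (fun ω => ‖A (traj p A b G s₀ ξ (k + 1) ω).x - rangeProj A b‖ ^ 2) μ :=
    hr.integrable_norm_pow (by norm_num)
  have hv2 : Integrable (fun ω => ‖direction A b p.ρ (traj p A b G s₀ ξ k ω)‖ ^ 2) μ :=
    (h.memLp_direction b s₀ k).integrable_norm_pow (by norm_num)
  exact ((((h.integrable_objective hx).add (integrable_inner_of_memLp_two hl' hr)).add
    (hr2.const_mul _)).add (hr2.const_mul _)).add (hv2.const_mul _)

theorem integrable_residual (h : RunAssumptions p A P μ f G V ξ) (b : EuclideanSpace ℝ (Fin m))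
    (s₀ : State d m) (k : ℕ) :
    Integrable (fun ω => residual p A b f G s₀ (fun j => ξ j ω) (k + 1)) μ ∧
    ∫ ω, residual p A b f G s₀ (fun j => ξ j ω) (k + 1) ∂μ
      = ∫ ω, ‖direction A b p.ρ (traj p A b G s₀ ξ k ω)‖ ^ 2 ∂μ
        + ∫ ω, ‖(traj p A b G s₀ ξ k ω).g - gradient f (traj p A b G s₀ ξ k ω).x‖ ^ 2 ∂μ := by
  simp_rw [residual_succ h.admissible]
  have hv2 : Integrable (fun ω => ‖direction A b p.ρ (traj p A b G s₀ ξ k ω)‖ ^ 2) μ :=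
    (h.memLp_direction b s₀ k).integrable_norm_pow (by norm_num)
  have he2 : Integrable (fun ω => ‖(traj p A b G s₀ ξ k ω).g
      - gradient f (traj p A b G s₀ ξ k ω).x‖ ^ 2) μ :=
    (h.memLp_error b s₀ k).integrable_norm_pow (by norm_num)
  exact ⟨hv2.add he2, integral_add hv2 he2⟩

/-- The sum of the weighted mean square residuals is bounded in terms of the first two iterates. -/
theorem sum_residual_le (h : RunAssumptions p A P μ f G V ξ) (b : EuclideanSpace ℝ (Fin m))
    (s₀ : State d m) (n : ℕ) :
    ∑ k ∈ Finset.range n, p.ηₖ (k + 2) *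
        ∫ ω, residual p A b f G s₀ (fun j => ξ j ω) (k + 1 + 1) ∂μ ≤
      5 / 2 * (∫ ω, pathPotential p A b f G s₀ ξ 0 ω ∂μ
        + 1 / (8 * p.Lf ^ 2) / p.ηₖ 1 * ∫ ω, ‖(traj p A b G s₀ ξ 1 ω).g
            - gradient f (traj p A b G s₀ ξ 1 ω).x‖ ^ 2 ∂μ
        + 1 / 20 * (p.ηₖ 1 * (∫ ω, ‖direction A b p.ρ (traj p A b G s₀ ξ 0 ω)‖ ^ 2 ∂μ
          + ∫ ω, ‖(traj p A b G s₀ ξ 0 ω).g - gradient f (traj p A b G s₀ ξ 0 ω).x‖ ^ 2 ∂μ))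
        + 8000 * p.Lf ^ 2 * V ^ 2 * p.η ^ 3) ∧
    ∀ k, ∫ ω, ‖(traj p A b G s₀ ξ (k + 1) ω).g
          - gradient f (traj p A b G s₀ ξ (k + 1) ω).x‖ ^ 2 ∂μ ≤
        (1 - p.αₖ (k + 1)) * ∫ ω, ‖(traj p A b G s₀ ξ k ω).g
          - gradient f (traj p A b G s₀ ξ k ω).x‖ ^ 2 ∂μ
        + 2 * p.Lf ^ 2 * (p.ηₖ (k + 1) ^ 2 *
          ∫ ω, ‖direction A b p.ρ (traj p A b G s₀ ξ k ω)‖ ^ 2 ∂μ)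
        + 2 * p.αₖ (k + 1) ^ 2 * V ^ 2 := by
  have hv2 : ∀ k, Integrable (fun ω => ‖direction A b p.ρ (traj p A b G s₀ ξ k ω)‖ ^ 2) μ :=
    fun k => (h.memLp_direction b s₀ k).integrable_norm_pow (by norm_num)
  have he2 : ∀ k, Integrable (fun ω => ‖(traj p A b G s₀ ξ k ω).g
      - gradient f (traj p A b G s₀ ξ k ω).x‖ ^ 2) μ :=
    fun k => (h.memLp_error b s₀ k).integrable_norm_pow (by norm_num)
  have hD2 : ∀ k, Integrable (fun ω => ‖(traj p A b G s₀ ξ (k + 1) ω).g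
      - (traj p A b G s₀ ξ k ω).g‖ ^ 2) μ := fun k =>
    (h.expectation_step b s₀ k (h.memLp_traj b s₀ k).1 (h.memLp_traj b s₀ k).2.1
      (h.memLp_traj b s₀ k).2.2).1.1
  have hl2 : ∀ k, Integrable (fun ω => ‖rangeProj A (traj p A b G s₀ ξ k ω).lam‖ ^ 2) μ :=
    fun k => MemLp.integrable_norm_pow (p := 2)
      ((rangeProj A).comp_memLp' (h.memLp_traj b s₀ k).2.1) (by norm_num)
  have hx : ∀ k ω, ‖(traj p A b G s₀ ξ (k + 1) ω).x - (traj p A b G s₀ ξ k ω).x‖ ^ 2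
      = p.ηₖ (k + 1) ^ 2 * ‖direction A b p.ρ (traj p A b G s₀ ξ k ω)‖ ^ 2 := fun k ω => by
    rw [traj_succ_x, add_sub_cancel_left, norm_smul, mul_pow, Real.norm_eq_abs, sq_abs]
  have hlin : ∀ {u v : Ω → ℝ} (_ : Integrable u μ) (_ : Integrable v μ) (a c t : ℝ),
      ∫ ω, (a * u ω + c * v ω + t) ∂μ = a * ∫ ω, u ω ∂μ + c * ∫ ω, v ω ∂μ + t := by
    intro u v hu hv a c t
    have huv : Integrable (fun ω => a * u ω + c * v ω) μ := (hu.const_mul a).add (hv.const_mul c)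
    rw [integral_add huv (integrable_const _), integral_add (hu.const_mul a) (hv.const_mul c),
      integral_const_mul, integral_const_mul, integral_const]
    simp only [probReal_univ, one_smul]
  have herr : ∀ k, ∫ ω, ‖(traj p A b G s₀ ξ (k + 1) ω).g
          - gradient f (traj p A b G s₀ ξ (k + 1) ω).x‖ ^ 2 ∂μ ≤
        (1 - p.αₖ (k + 1)) * ∫ ω, ‖(traj p A b G s₀ ξ k ω).g
          - gradient f (traj p A b G s₀ ξ k ω).x‖ ^ 2 ∂μ
        + 2 * p.Lf ^ 2 * (p.ηₖ (k + 1) ^ 2 *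
          ∫ ω, ‖direction A b p.ρ (traj p A b G s₀ ξ k ω)‖ ^ 2 ∂μ)
        + 2 * p.αₖ (k + 1) ^ 2 * V ^ 2 := fun k => by
    have hk := (h.expectation_step b s₀ k (h.memLp_traj b s₀ k).1 (h.memLp_traj b s₀ k).2.1
      (h.memLp_traj b s₀ k).2.2).2
    simp_rw [hx] at hk
    rwa [hlin (he2 k) ((hv2 k).const_mul _), integral_const_mul] at hk
  -- The recursion is returned too: its case k = 0 bounds the error at index 1 occurring in the
  -- initial potential.
  refine ⟨?_, herr⟩
  simp_rw [fun k => (h.integrable_residual b s₀ (k + 1)).2]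
  refine h.admissible.sum_le_of_recursion
    (w := fun k => ∫ ω, ‖direction A b p.ρ (traj p A b G s₀ ξ k ω)‖ ^ 2 ∂μ)
    (e := fun k => ∫ ω, ‖(traj p A b G s₀ ξ k ω).g
      - gradient f (traj p A b G s₀ ξ k ω).x‖ ^ 2 ∂μ)
    (D := fun k => ∫ ω, ‖(traj p A b G s₀ ξ (k + 1) ω).g - (traj p A b G s₀ ξ k ω).g‖ ^ 2 ∂μ)
    (π := fun k => ∫ ω, pathPotential p A b f G s₀ ξ k ω ∂μ)
    (q := fun k => ∫ ω, ‖rangeProj A (traj p A b G s₀ ξ k ω).lam‖ ^ 2 ∂μ)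
    (fun k => integral_nonneg fun ω => by positivity)
    (fun k => integral_nonneg fun ω => by positivity)
    (fun k => integral_nonneg fun ω => by positivity) (fun k => ?_) (fun k => ?_) herr
    (fun k => ?_) n
  · have i0 := h.integrable_pathPotential b s₀ k
    have i1 := (hv2 (k + 1)).const_mul (7 / 10 * p.ηₖ (k + 2))
    have i2 := (he2 (k + 1)).const_mul (p.ηₖ (k + 2))
    have i3 := (hv2 k).const_mul (1 / 1000 * p.ηₖ (k + 1))
    have i4 := (hD2 k).const_mul (p.m / (p.Lf * p.ηₖ (k + 2)))
    have hmono := integral_mono (h.integrable_pathPotential b s₀ (k + 1))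
      ((((i0.sub i1).add i2).add i3).add i4) (h.pathPotential_succ_le b s₀ k)
    rw [integral_add' (((i0.sub i1).add i2).add i3) i4, integral_add' ((i0.sub i1).add i2) i3,
      integral_add' (i0.sub i1) i2, integral_sub' i0 i1] at hmono
    simp only [integral_const_mul] at hmono
    exact hmono
  · have hk := (h.expectation_step b s₀ k (h.memLp_traj b s₀ k).1 (h.memLp_traj b s₀ k).2.1
      (h.memLp_traj b s₀ k).2.2).1.2
    simp_rw [hx] at hk
    rwa [hlin ((hv2 k).const_mul _) (he2 k), integral_const_mul] at hk
  · have hmono := integral_mono (((hl2 (k + 1)).sub (hl2 k)).const_mul (1 / (2 * p.ρ)))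
      (h.integrable_pathPotential b s₀ k) (h.le_pathPotential b s₀ k)
    rw [integral_const_mul, integral_sub' (hl2 (k + 1)) (hl2 k)] at hmono
    exact hmono

end RunAssumptions

/-! ### A constant independent of the objective -/

section Constant

variable {d m : ℕ}

/-- A bound on the objective at the first iterate, from a bound `F₀` at the starting point. -/
noncomputable def firstObjectiveBound (p : ParamData)
    (A : EuclideanSpace ℝ (Fin d) →L[ℝ] EuclideanSpace ℝ (Fin m)) (b : EuclideanSpace ℝ (Fin m))
    (s₀ : State d m) (F₀ : ℝ) : ℝ :=
  F₀ + p.Lf * F₀ + (1 + p.Lf) / 2 * (p.ηₖ 1 ^ 2 * ‖direction A b p.ρ s₀‖ ^ 2)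

/-- A bound on the initial potential. -/
noncomputable def firstPotentialBound (p : ParamData)
    (A : EuclideanSpace ℝ (Fin d) →L[ℝ] EuclideanSpace ℝ (Fin m)) (b : EuclideanSpace ℝ (Fin m))
    (s₀ : State d m) (F₀ : ℝ) : ℝ :=
  potential (fun _ => firstObjectiveBound p A b s₀ F₀) A (rangeProj A b) p.ρ p.m (p.ηₖ 2)
    (s₀.x + p.ηₖ 1 • direction A b p.ρ s₀)
    (rangeProj A s₀.lam + p.ρ • (A (s₀.x + p.ηₖ 1 • direction A b p.ρ s₀) - rangeProj A b))
    (direction A b p.ρ s₀)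

/-- A bound on the initial squared gradient error. -/
noncomputable def initialErrorBound (p : ParamData) (s₀ : State d m) (F₀ : ℝ) : ℝ :=
  2 * ‖s₀.g‖ ^ 2 + 4 * p.Lf * F₀

/-- The constant in the convergence rate. -/
noncomputable def rateConstant (p : ParamData)
    (A : EuclideanSpace ℝ (Fin d) →L[ℝ] EuclideanSpace ℝ (Fin m)) (b : EuclideanSpace ℝ (Fin m))
    (s₀ : State d m) (V F₀ : ℝ) : ℝ :=
  p.ηₖ 1 * (‖direction A b p.ρ s₀‖ ^ 2 + initialErrorBound p s₀ F₀)
    + 5 / 2 * (firstPotentialBound p A b s₀ F₀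
      + 1 / (8 * p.Lf ^ 2) / p.ηₖ 1 * (initialErrorBound p s₀ F₀
        + 2 * p.Lf ^ 2 * (p.ηₖ 1 ^ 2 * ‖direction A b p.ρ s₀‖ ^ 2) + 2 * p.αₖ 1 ^ 2 * V ^ 2)
      + 1 / 20 * (p.ηₖ 1 * (‖direction A b p.ρ s₀‖ ^ 2 + initialErrorBound p s₀ F₀))
      + 8000 * p.Lf ^ 2 * V ^ 2 * p.η ^ 3)

end Constant

namespace RunAssumptions

variable {d m : ℕ} {Ξ Ω : Type*} [MeasurableSpace Ξ] [MeasurableSpace Ω] {p : ParamData}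
  {A : EuclideanSpace ℝ (Fin d) →L[ℝ] EuclideanSpace ℝ (Fin m)} {P : Measure Ξ} {μ : Measure Ω}
  {f : EuclideanSpace ℝ (Fin d) → ℝ}
  {G : EuclideanSpace ℝ (Fin d) → Ξ → EuclideanSpace ℝ (Fin d)} {V : ℝ} {ξ : ℕ → Ω → Ξ}
  [IsProbabilityMeasure P]

theorem norm_gradient_sq_le_of_le (h : RunAssumptions p A P μ f G V ξ)
    {x₀ : EuclideanSpace ℝ (Fin d)} {F₀ : ℝ} (hF : f x₀ ≤ F₀) :
    ‖gradient f x₀‖ ^ 2 ≤ 2 * p.Lf * F₀ := by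
  have hL := h.admissible.Lf_pos
  refine (norm_gradient_sq_le h.oracle.differentiable hL (h.oracle.gradient_lipschitz hL)
    h.oracle.nonneg x₀).trans ?_
  gcongr

theorem norm_initial_error_sq_le (h : RunAssumptions p A P μ f G V ξ) {s₀ : State d m} {F₀ : ℝ}
    (hF : f s₀.x ≤ F₀) : ‖s₀.g - gradient f s₀.x‖ ^ 2 ≤ initialErrorBound p s₀ F₀ := by
  have h1 := norm_sub_sq_le_two s₀.g (gradient f s₀.x)
  have h2 := h.norm_gradient_sq_le_of_le hF
  unfold initialErrorBound
  linarith

/-- The first iterate x₁ is deterministic and f enters only through f(x₁). The quadratic upper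
bound, Young's inequality and ‖∇f(x₀)‖² ≤ 2LF₀ bound that value by F₀ and the data, uniformly in f.
-/
theorem pathPotential_zero_le (h : RunAssumptions p A P μ f G V ξ) {b : EuclideanSpace ℝ (Fin m)}
    {s₀ : State d m} {F₀ : ℝ} (hF : f s₀.x ≤ F₀) (ω : Ω) :
    pathPotential p A b f G s₀ ξ 0 ω ≤ firstPotentialBound p A b s₀ F₀ := by
  have hL := h.admissible.Lf_pos
  have hx : (traj p A b G s₀ ξ (0 + 1) ω).x = s₀.x + p.ηₖ 1 • direction A b p.ρ s₀ :=
    traj_succ_x 0 ω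
  have hf : f (s₀.x + p.ηₖ 1 • direction A b p.ρ s₀) ≤ firstObjectiveBound p A b s₀ F₀ := by
    have h1 := le_add_inner_gradient_add h.oracle.differentiable (h.oracle.gradient_lipschitz hL)
      s₀.x (p.ηₖ 1 • direction A b p.ρ s₀)
    have h2 := h.norm_gradient_sq_le_of_le hF
    have h3 := real_inner_le_norm (gradient f s₀.x) (p.ηₖ 1 • direction A b p.ρ s₀)
    have h4 : ‖p.ηₖ 1 • direction A b p.ρ s₀‖ ^ 2
        = p.ηₖ 1 ^ 2 * ‖direction A b p.ρ s₀‖ ^ 2 := by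
      rw [norm_smul, mul_pow, Real.norm_eq_abs, sq_abs]
    unfold firstObjectiveBound
    rw [← h4]
    nlinarith [sq_nonneg (‖gradient f s₀.x‖ - ‖p.ηₖ 1 • direction A b p.ρ s₀‖)]
  unfold pathPotential firstPotentialBound
  rw [rangeProj_traj_succ_lam, hx]
  change potential f A (rangeProj A b) p.ρ p.m (p.ηₖ 2) (s₀.x + p.ηₖ 1 • direction A b p.ρ s₀)
    (rangeProj A s₀.lam + p.ρ • (A (s₀.x + p.ηₖ 1 • direction A b p.ρ s₀) - rangeProj A b))
    (direction A b p.ρ s₀) ≤ _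
  unfold potential augLagrangian
  linarith

variable [IsProbabilityMeasure μ]

/-- The weighted sum of the mean square residuals is bounded uniformly in the horizon. -/
theorem sum_weighted_residual_le (h : RunAssumptions p A P μ f G V ξ)
    {b : EuclideanSpace ℝ (Fin m)} {s₀ : State d m} {F₀ : ℝ} (hF : f s₀.x ≤ F₀) (n : ℕ) :
    ∑ k ∈ Finset.range (n + 1), p.ηₖ (k + 1) *
        ∫ ω, residual p A b f G s₀ (fun j => ξ j ω) (k + 1) ∂μ ≤ rateConstant p A b s₀ V F₀ := by
  have hp := h.admissible
  have hL := hp.Lf_pos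
  have hη := hp.ηₖ_pos 1
  obtain ⟨hsum, herr⟩ := h.sum_residual_le b s₀ n
  have herr0 := herr 0
  have hw0 : ∫ ω, ‖direction A b p.ρ (traj p A b G s₀ ξ 0 ω)‖ ^ 2 ∂μ
      = ‖direction A b p.ρ s₀‖ ^ 2 := by
    change ∫ _, ‖direction A b p.ρ s₀‖ ^ 2 ∂μ = _
    rw [integral_const, probReal_univ, one_smul]
  have he0 : ∫ ω, ‖(traj p A b G s₀ ξ 0 ω).g - gradient f (traj p A b G s₀ ξ 0 ω).x‖ ^ 2 ∂μ
      = ‖s₀.g - gradient f s₀.x‖ ^ 2 := by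
    change ∫ _, ‖s₀.g - gradient f s₀.x‖ ^ 2 ∂μ = _
    rw [integral_const, probReal_univ, one_smul]
  have hpot : ∫ ω, pathPotential p A b f G s₀ ξ 0 ω ∂μ ≤ firstPotentialBound p A b s₀ F₀ := by
    have := integral_mono (h.integrable_pathPotential b s₀ 0) (integrable_const _)
      fun ω => h.pathPotential_zero_le (b := b) hF ω
    rwa [integral_const, probReal_univ, one_smul] at this
  have hE := h.norm_initial_error_sq_le hF
  have hα := hp.αₖ_nonneg 1
  -- The first, deterministic summand is split off, since the recursion controls only later ones.
  rw [Finset.sum_range_succ', (h.integrable_residual b s₀ 0).2]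
  rw [zero_add, hw0, he0] at herr0
  rw [hw0, he0] at hsum ⊢
  rw [zero_add]
  have he1 : ∫ ω, ‖(traj p A b G s₀ ξ 1 ω).g - gradient f (traj p A b G s₀ ξ 1 ω).x‖ ^ 2 ∂μ ≤
      initialErrorBound p s₀ F₀ + 2 * p.Lf ^ 2 * (p.ηₖ 1 ^ 2 * ‖direction A b p.ρ s₀‖ ^ 2)
        + 2 * p.αₖ 1 ^ 2 * V ^ 2 := by
    have := mul_nonneg hα (sq_nonneg ‖s₀.g - gradient f s₀.x‖)
    linarith
  have t1 := mul_le_mul_of_nonneg_left he1 (show 0 ≤ 1 / (8 * p.Lf ^ 2) / p.ηₖ 1 by positivity)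
  have t2 := mul_le_mul_of_nonneg_left hE hη.le
  unfold rateConstant
  linarith

end RunAssumptions

end StochLALM

/-! ### The convergence rate -/

theorem mainTheorem5 {d m : ℕ}
    (A : EuclideanSpace ℝ (Fin d) →L[ℝ] EuclideanSpace ℝ (Fin m))
    (b : EuclideanSpace ℝ (Fin m))
    (Lf V δ c₁ c₂ c₃ c₄ : ℝ) (hLf : 0 < Lf)
    (hδ : StochLALM.IsSmallestNonzeroEigenvalue A δ)
    (hc₁ : 0 < c₁) (hc₂ : 0 < c₂) (hc₃ : 0 < c₃) (hc₄ : 0 < c₄)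
    (p : StochLALM.ParamData) (hp : p = ⟨Lf, δ, ‖A‖, c₁, c₂, c₃, c₄⟩)
    (x₀ g₀ : EuclideanSpace ℝ (Fin d)) (lam₀ : EuclideanSpace ℝ (Fin m)) (F₀ : ℝ) :
    -- the constants do not depend on `K`, on the objective, on its oracle or on the samples
    ∃ C C' : ℝ,
      (∀ {Ξ : Type*} [MeasurableSpace Ξ] (P : Measure Ξ) [IsProbabilityMeasure P]
        {Ω : Type*} [MeasurableSpace Ω] (μ : Measure Ω) [IsProbabilityMeasure μ]
        (f : EuclideanSpace ℝ (Fin d) → ℝ)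
        (G : EuclideanSpace ℝ (Fin d) → Ξ → EuclideanSpace ℝ (Fin d))
        (ξ : ℕ → Ω → Ξ),
        StochLALM.OracleAssumptions P f G Lf V →
        f x₀ ≤ F₀ →
        (∀ k : ℕ, MeasurePreserving (ξ (k + 1)) μ P) →
        iIndepFun (fun k : ℕ => ξ (k + 1)) μ →
        (∀ k : ℕ, 1 ≤ k → Integrable
          (fun ω => StochLALM.residual p A b f G ⟨x₀, lam₀, g₀⟩ (fun j => ξ j ω) k) μ) ∧
        ∀ K : ℕ, 1 ≤ K →
          (1 / (K : ℝ)) * ∑ k ∈ Finset.Icc 1 (K + 1),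
              ∫ ω, StochLALM.residual p A b f G ⟨x₀, lam₀, g₀⟩ (fun j => ξ j ω) k ∂μ
            ≤ C * (1 / (p.ηₖ (K + 1) * (K : ℝ)))) ∧
      ∀ K : ℕ, 1 ≤ K →
        C * (1 / (p.ηₖ (K + 1) * (K : ℝ)))
          ≤ C' * ((K : ℝ) ^ (-(2 / 3) : ℝ) * Real.log ((K : ℝ) + 1)) := by
  have hadm : p.Admissible := by
    subst hp
    exact ⟨hLf, hδ.pos, norm_nonneg A, hc₁, hc₂, hc₃⟩
  -- F₀ is an arbitrary real number at this point, so nonnegativity of C, needed to multiply the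
  -- bound on 1/(η_{K+1}K), is forced by the maximum.
  set C : ℝ := max 0 (StochLALM.rateConstant p A b ⟨x₀, lam₀, g₀⟩ V F₀)
  refine ⟨C, C * ((2 + p.k₀) ^ (1 / 3 : ℝ) * (1 + Real.log (1 + p.k₀) / Real.log 2) / p.η),
    ?_, fun K hK => ?_⟩
  · intro Ξ _ P _ Ω _ μ _ f G ξ hor hF hsample hind
    have hrun : StochLALM.RunAssumptions p A P μ f G V ξ := by
      subst hp
      exact ⟨hadm, rfl, hδ, hor, hsample, hind⟩
    refine ⟨fun k hk => ?_, fun K hK => ?_⟩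
    · obtain ⟨j, rfl⟩ := Nat.exists_eq_add_of_le' hk
      exact (hrun.integrable_residual b _ j).1
    · have hK0 : (0 : ℝ) < K := by exact_mod_cast hK
      have hηK := hadm.ηₖ_pos (K + 1)
      have hsum := (hrun.sum_weighted_residual_le (b := b) (s₀ := ⟨x₀, lam₀, g₀⟩) hF K).trans
        (le_max_right 0 _)
      have hre : ∑ k ∈ Finset.Icc 1 (K + 1),
            ∫ ω, StochLALM.residual p A b f G ⟨x₀, lam₀, g₀⟩ (fun j => ξ j ω) k ∂μ
          = ∑ k ∈ Finset.range (K + 1),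
            ∫ ω, StochLALM.residual p A b f G ⟨x₀, lam₀, g₀⟩ (fun j => ξ j ω) (k + 1) ∂μ := by
        rw [Finset.range_eq_Ico, Finset.sum_Ico_add'
          (fun k => ∫ ω, StochLALM.residual p A b f G ⟨x₀, lam₀, g₀⟩ (fun j => ξ j ω) k ∂μ)]
        rfl
      -- Each weight η_{k+1} with k ≤ K is at least η_{K+1}, and the residuals are nonnegative.
      have hle : p.ηₖ (K + 1) * ∑ k ∈ Finset.range (K + 1),
            ∫ ω, StochLALM.residual p A b f G ⟨x₀, lam₀, g₀⟩ (fun j => ξ j ω) (k + 1) ∂μ ≤ C := by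
        refine le_trans ?_ hsum
        rw [Finset.mul_sum]
        refine Finset.sum_le_sum fun k hk => mul_le_mul_of_nonneg_right
          (hadm.ηₖ_antitone (by have := Finset.mem_range.1 hk; omega)) ?_
        exact integral_nonneg fun ω => by unfold StochLALM.residual; positivity
      rw [hre, one_div_mul_eq_div, mul_one_div, div_le_div_iff₀ hK0 (by positivity)]
      calc _ = p.ηₖ (K + 1) * (∑ k ∈ Finset.range (K + 1),
            ∫ ω, StochLALM.residual p A b f G ⟨x₀, lam₀, g₀⟩ (fun j => ξ j ω) (k + 1) ∂μ) * K := by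
            ring
        _ ≤ C * K := by gcongr
  · rw [mul_assoc]
    exact mul_le_mul_of_nonneg_left (hadm.one_div_ηₖ_mul_le hK) (le_max_left _ _)
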